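/- All Lie algebras are over a fixed field $F$. For an ideal $N$ of a Lie algebra $L$ (a \emph{pair} $(L,N)$), the nonabelian tensor product $L\otimes N$ is the Lie algebra generated by symbols $l\otimes n$ ($l\in L$, $n\in N$) subject to \[c(l\otimes n)=cl\otimes n=l\otimes cn,\quad (l+l')\otimes n=l\otimes n+l'\otimes n,\quad l\otimes(n+n')=l\otimes n+l\otimes n',\] \[[l,l']\otimes n=l\otimes[l',n]-l'\otimes[l,n],\quad l\otimes[n,n']=[n',l]\otimes n-[n,l]\otimes n',\quad [l\otimes n,l'\otimes n']=-[n,l]\otimes[l',n'].\] Let $\kappa_{L,N}:L\otimes N\to [L,N]$, $l\otimes n\mapsto[l,n]$, and $J_2(L,N)=\ker\kappa_{L,N}$. Let $L\,\square\,N$ (the diagonal ideal) be the ideal of $L\otimes N$ generated by all $n\otimes n$ with $n\in N$, let $L\wedge N=(L\otimes N)/(L\,\square\,N)$, and let the Schur multiplier $M(L,N)$ of the pair be the kernel of the induced map $\kappa'_{L,N}:L\wedge N\to[L,N]$, $l\wedge n\mapsto [l,n]$. Write $L_1*L_2$ for the free product (coproduct) of Lie algebras. \textbf{Theorem.} Let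 $N_1$ and $N_2$ be ideals of finite-dimensional Lie algebras $L_1$ and $L_2$ over $F$ such that $(L_1*L_2,\,N_1*N_2)$ is a pair, i.e. such that $N_1*N_2$ (regarded as a subalgebra of $L_1*L_2$ through the natural map) is an ideal of $L_1*L_2$. Then there are isomorphisms of Lie algebras: \begin{itemize} \item[(i)] $J_2(L_1*L_2,\,N_1*N_2)\simeq J_2(L_1,N_1)\oplus J_2(L_2,N_2)\oplus\left(\dfrac{N_1}{[N_1,L_1]}\otimes\dfrac{N_2}{[N_2,L_2]}\right)$, where the last summand is the tensor product of abelian Lie algebras acting trivially on each other; \item[(ii)] $(L_1*L_2)\,\square\,(N_1*N_2)\simeq(L_1\oplus L_2)\,\square\,(N_1\oplus N_2)$; \item[(iii)] $M(L_1*L_2,\,N_1*N_2)\simeq M(L_1,N_1)\oplus M(L_2,N_2)$, whenever $N_1$ has a complement in $L_1$ (a subalgebra $K$ with $L_1=N_1\oplus K$ as vector spaces) and $[N_1,L_1]=[L_1,L_1]$. \end{itemize} -/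

import Mathlib

noncomputable section

namespace LiePair

universe u v w z

section Quotient

variable {F : Type u} {L : Type v} {M : Type w} [Field F] [LieRing L] [LieAlgebra F L]
  [LieRing M] [LieAlgebra F M]

/-- The projection onto the quotient by an ideal, as a morphism of Lie algebras. -/
def quotMk (I : LieIdeal F L) : L →ₗ⁅F⁆ L ⧸ I :=
  { (LieSubmodule.Quotient.mk' I : L →ₗ[F] L ⧸ I) with
    map_lie' := fun {x y} => LieSubmodule.Quotient.mk_bracket I x y }

/-- A morphism of Lie algebras that kills an ideal descends to the quotient. -/
def quotLift (I : LieIdeal F L) (f : L →ₗ⁅F⁆ M) (h : I ≤ f.ker) : L ⧸ I →ₗ⁅F⁆ M :=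
  { I.toSubmodule.liftQ (f : L →ₗ[F] M) (fun x hx => by
      have := h hx
      rw [LieHom.mem_ker] at this
      simpa using this) with
    map_lie' := fun {x y} => by
      induction x using Submodule.Quotient.induction_on
      induction y using Submodule.Quotient.induction_on
      exact f.map_lie _ _ }

theorem quotLift_mk (I : LieIdeal F L) (f : L →ₗ⁅F⁆ M) (h : I ≤ f.ker) (x : L) :
    quotLift I f h (quotMk I x) = f x := rfl

end Quotient

section FreeProduct

variable (F : Type u) (L₁ : Type v) (L₂ : Type w) [Field F] [LieRing L₁] [LieAlgebra F L₁]
  [LieRing L₂] [LieAlgebra F L₂]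

/-- The relators saying that the two maps `L₁ → L₁ * L₂` and `L₂ → L₁ * L₂` are morphisms of
Lie algebras. -/
inductive FreeProdRelator : FreeLieAlgebra F (L₁ ⊕ L₂) → Prop
  | add_left (x y : L₁) : FreeProdRelator
      (FreeLieAlgebra.of F (Sum.inl (x + y)) -
        (FreeLieAlgebra.of F (Sum.inl x) + FreeLieAlgebra.of F (Sum.inl y)))
  | smul_left (c : F) (x : L₁) : FreeProdRelator
      (FreeLieAlgebra.of F (Sum.inl (c • x)) - c • FreeLieAlgebra.of F (Sum.inl x))
  | lie_left (x y : L₁) : FreeProdRelator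
      (FreeLieAlgebra.of F (Sum.inl ⁅x, y⁆) -
        ⁅FreeLieAlgebra.of F (Sum.inl x : L₁ ⊕ L₂), FreeLieAlgebra.of F (Sum.inl y : L₁ ⊕ L₂)⁆)
  | add_right (x y : L₂) : FreeProdRelator
      (FreeLieAlgebra.of F (Sum.inr (x + y)) -
        (FreeLieAlgebra.of F (Sum.inr x) + FreeLieAlgebra.of F (Sum.inr y)))
  | smul_right (c : F) (x : L₂) : FreeProdRelator
      (FreeLieAlgebra.of F (Sum.inr (c • x)) - c • FreeLieAlgebra.of F (Sum.inr x))
  | lie_right (x y : L₂) : FreeProdRelator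
      (FreeLieAlgebra.of F (Sum.inr ⁅x, y⁆) -
        ⁅FreeLieAlgebra.of F (Sum.inr x : L₁ ⊕ L₂), FreeLieAlgebra.of F (Sum.inr y : L₁ ⊕ L₂)⁆)

/-- The ideal generated by the relators of the free product. -/
def freeProdIdeal : LieIdeal F (FreeLieAlgebra F (L₁ ⊕ L₂)) :=
  LieSubmodule.lieSpan F (FreeLieAlgebra F (L₁ ⊕ L₂)) {x | FreeProdRelator F L₁ L₂ x}

/-- The free product (coproduct) `L₁ * L₂` of two Lie algebras over `F`. -/
abbrev FreeProd : Type _ := FreeLieAlgebra F (L₁ ⊕ L₂) ⧸ freeProdIdeal F L₁ L₂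

variable {F L₁ L₂}

theorem FreeProdRelator.quotMk_eq_zero {x : FreeLieAlgebra F (L₁ ⊕ L₂)}
    (h : FreeProdRelator F L₁ L₂ x) : quotMk (freeProdIdeal F L₁ L₂) x = 0 :=
  LieSubmodule.Quotient.mk_eq_zero'.mpr (LieSubmodule.subset_lieSpan h)

variable (F L₁ L₂)

/-- The natural morphism `L₁ → L₁ * L₂`. -/
def FreeProd.inl : L₁ →ₗ⁅F⁆ FreeProd F L₁ L₂ where
  toFun x := quotMk (freeProdIdeal F L₁ L₂) (FreeLieAlgebra.of F (Sum.inl x))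
  map_add' x y := by
    simpa [sub_eq_zero] using (FreeProdRelator.add_left (F := F) (L₂ := L₂) x y).quotMk_eq_zero
  map_smul' c x := by
    simpa [sub_eq_zero] using (FreeProdRelator.smul_left (F := F) (L₂ := L₂) c x).quotMk_eq_zero
  map_lie' {x y} := by
    simpa [sub_eq_zero] using (FreeProdRelator.lie_left (F := F) (L₂ := L₂) x y).quotMk_eq_zero

/-- The natural morphism `L₂ → L₁ * L₂`. -/
def FreeProd.inr : L₂ →ₗ⁅F⁆ FreeProd F L₁ L₂ where
  toFun x := quotMk (freeProdIdeal F L₁ L₂) (FreeLieAlgebra.of F (Sum.inr x))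
  map_add' x y := by
    simpa [sub_eq_zero] using (FreeProdRelator.add_right (F := F) (L₁ := L₁) x y).quotMk_eq_zero
  map_smul' c x := by
    simpa [sub_eq_zero] using (FreeProdRelator.smul_right (F := F) (L₁ := L₁) c x).quotMk_eq_zero
  map_lie' {x y} := by
    simpa [sub_eq_zero] using (FreeProdRelator.lie_right (F := F) (L₁ := L₁) x y).quotMk_eq_zero

variable {F L₁ L₂} {M : Type z} [LieRing M] [LieAlgebra F M]

/-- The morphism `L₁ * L₂ → M` given by two morphisms `L₁ → M` and `L₂ → M`. -/
def FreeProd.lift (f : L₁ →ₗ⁅F⁆ M) (g : L₂ →ₗ⁅F⁆ M) : FreeProd F L₁ L₂ →ₗ⁅F⁆ M :=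
  quotLift (freeProdIdeal F L₁ L₂) (FreeLieAlgebra.lift F (Sum.elim f g)) (by
    rw [freeProdIdeal, LieSubmodule.lieSpan_le]
    rintro x hx
    rw [SetLike.mem_coe, LieHom.mem_ker]
    cases hx <;> simp)

theorem FreeProd.lift_inl (f : L₁ →ₗ⁅F⁆ M) (g : L₂ →ₗ⁅F⁆ M) (x : L₁) :
    FreeProd.lift f g (FreeProd.inl F L₁ L₂ x) = f x :=
  (quotLift_mk _ _ _ _).trans (by simp)

theorem FreeProd.lift_inr (f : L₁ →ₗ⁅F⁆ M) (g : L₂ →ₗ⁅F⁆ M) (x : L₂) :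
    FreeProd.lift f g (FreeProd.inr F L₁ L₂ x) = g x :=
  (quotLift_mk _ _ _ _).trans (by simp)

/-- The free product `N₁ * N₂` of two ideals, regarded as a subalgebra of `L₁ * L₂` through the
natural morphism `N₁ * N₂ → L₁ * L₂`. -/
def freeProdSubalgebra (N₁ : LieIdeal F L₁) (N₂ : LieIdeal F L₂) :
    LieSubalgebra F (FreeProd F L₁ L₂) :=
  (FreeProd.lift ((FreeProd.inl F L₁ L₂).comp N₁.incl)
    ((FreeProd.inr F L₁ L₂).comp N₂.incl) :
      FreeProd F N₁ N₂ →ₗ⁅F⁆ FreeProd F L₁ L₂).range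

/-- The ideal `N₁ ⊕ N₂` of the direct sum `L₁ ⊕ L₂`. -/
def prodIdeal (N₁ : LieIdeal F L₁) (N₂ : LieIdeal F L₂) : LieIdeal F (L₁ × L₂) :=
  LieIdeal.comap (LieHom.fst F L₁ L₂) N₁ ⊓ LieIdeal.comap (LieHom.snd F L₁ L₂) N₂

theorem mem_prodIdeal (N₁ : LieIdeal F L₁) (N₂ : LieIdeal F L₂) (x : L₁ × L₂) :
    x ∈ prodIdeal N₁ N₂ ↔ x.1 ∈ N₁ ∧ x.2 ∈ N₂ := by
  simp [prodIdeal]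

end FreeProduct

section Tensor

variable {F : Type u} {L : Type v} {N : Type w} [Field F] [LieRing L] [LieAlgebra F L]
  [LieRing N] [LieAlgebra F N]

/-- The relators of the nonabelian tensor product `L ⊗ N` of two Lie algebras acting on each
other: `φ l n` is `ˡn` and `ψ n l` is `ⁿl`. An action of `L` on `N` is a morphism of Lie algebras
from `L` to the derivations of `N`. -/
inductive TensorRelator (φ : L →ₗ⁅F⁆ LieDerivation F N N) (ψ : N →ₗ⁅F⁆ LieDerivation F L L) :
    FreeLieAlgebra F (L × N) → Prop
  | smul_left (c : F) (l : L) (n : N) : TensorRelator φ ψ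
      (c • FreeLieAlgebra.of F (l, n) - FreeLieAlgebra.of F (c • l, n))
  | smul_right (c : F) (l : L) (n : N) : TensorRelator φ ψ
      (c • FreeLieAlgebra.of F (l, n) - FreeLieAlgebra.of F (l, c • n))
  | add_left (l l' : L) (n : N) : TensorRelator φ ψ
      (FreeLieAlgebra.of F (l + l', n) -
        (FreeLieAlgebra.of F (l, n) + FreeLieAlgebra.of F (l', n)))
  | add_right (l : L) (n n' : N) : TensorRelator φ ψ
      (FreeLieAlgebra.of F (l, n + n') -
        (FreeLieAlgebra.of F (l, n) + FreeLieAlgebra.of F (l, n')))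
  | lie_left (l l' : L) (n : N) : TensorRelator φ ψ
      (FreeLieAlgebra.of F (⁅l, l'⁆, n) -
        (FreeLieAlgebra.of F (l, φ l' n) - FreeLieAlgebra.of F (l', φ l n)))
  | lie_right (l : L) (n n' : N) : TensorRelator φ ψ
      (FreeLieAlgebra.of F (l, ⁅n, n'⁆) -
        (FreeLieAlgebra.of F (ψ n' l, n) - FreeLieAlgebra.of F (ψ n l, n')))
  | lie_lie (l l' : L) (n n' : N) : TensorRelator φ ψ
      (⁅FreeLieAlgebra.of F (l, n), FreeLieAlgebra.of F (l', n')⁆ -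
        (-FreeLieAlgebra.of F (ψ n l, φ l' n')))

/-- The ideal generated by the relators of the nonabelian tensor product. -/
def tensorIdeal (φ : L →ₗ⁅F⁆ LieDerivation F N N) (ψ : N →ₗ⁅F⁆ LieDerivation F L L) :
    LieIdeal F (FreeLieAlgebra F (L × N)) :=
  LieSubmodule.lieSpan F (FreeLieAlgebra F (L × N)) {x | TensorRelator φ ψ x}

/-- The nonabelian tensor product `L ⊗ N` with respect to mutual actions `φ` and `ψ`. -/
abbrev NonabTensor (φ : L →ₗ⁅F⁆ LieDerivation F N N) (ψ : N →ₗ⁅F⁆ LieDerivation F L L) :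
    Type _ :=
  FreeLieAlgebra F (L × N) ⧸ tensorIdeal φ ψ

/-- The generator `l ⊗ n`. -/
def tmul (φ : L →ₗ⁅F⁆ LieDerivation F N N) (ψ : N →ₗ⁅F⁆ LieDerivation F L L) (l : L) (n : N) :
    NonabTensor φ ψ :=
  quotMk (tensorIdeal φ ψ) (FreeLieAlgebra.of F (l, n))

end Tensor

section Pair

variable {F : Type u} {L : Type v} [Field F] [LieRing L] [LieAlgebra F L]

/-- The action of `L` on its ideal `N` by Lie multiplication. -/
def actOnIdeal (N : LieIdeal F L) : L →ₗ⁅F⁆ LieDerivation F N N where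
  toFun l :=
    { toFun := fun n => ⟨⁅l, (n : L)⁆, N.lie_mem n.2⟩
      map_add' := fun n n' => Subtype.ext (lie_add l (n : L) (n' : L))
      map_smul' := fun c n => Subtype.ext (lie_smul c l (n : L))
      leibniz' := fun n n' => Subtype.ext (by
        change ⁅l, ⁅(n : L), (n' : L)⁆⁆ = ⁅(n : L), ⁅l, (n' : L)⁆⁆ - ⁅(n' : L), ⁅l, (n : L)⁆⁆
        rw [leibniz_lie l (n : L) (n' : L), ← lie_skew (n' : L) ⁅l, (n : L)⁆]
        abel) }
  map_add' l l' := LieDerivation.ext fun n => Subtype.ext (add_lie l l' (n : L))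
  map_smul' c l := LieDerivation.ext fun n => Subtype.ext (smul_lie c l (n : L))
  map_lie' {l l'} := LieDerivation.ext fun n => by
    rw [LieDerivation.commutator_apply]
    exact Subtype.ext (lie_lie l l' (n : L))

/-- The action of an ideal `N` on `L` by Lie multiplication. -/
def idealAct (N : LieIdeal F L) : N →ₗ⁅F⁆ LieDerivation F L L :=
  (LieDerivation.ad F L).comp N.incl

theorem idealAct_apply (N : LieIdeal F L) (n : N) (l : L) : idealAct N n l = ⁅(n : L), l⁆ := by
  simp [idealAct]

/-- The nonabelian tensor product `L ⊗ N` of a pair `(L, N)`. -/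
abbrev PairTensor (N : LieIdeal F L) : Type _ := NonabTensor (actOnIdeal N) (idealAct N)

/-- The commutator map `κ : L ⊗ N → L`, `l ⊗ n ↦ [l, n]`; its image is `[L, N]`. -/
def kappa (N : LieIdeal F L) : PairTensor N →ₗ⁅F⁆ L :=
  quotLift (tensorIdeal (actOnIdeal N) (idealAct N))
    (FreeLieAlgebra.lift F fun p : L × N => ⁅p.1, (p.2 : L)⁆) (by
      rw [tensorIdeal, LieSubmodule.lieSpan_le]
      rintro x hx
      rw [SetLike.mem_coe, LieHom.mem_ker]
      cases hx with
      | smul_left c l n => simp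
      | smul_right c l n => simp
      | add_left l l' n => simp
      | add_right l n n' => simp
      | lie_left l l' n =>
        simp only [map_sub, FreeLieAlgebra.lift_of_apply]
        change ⁅⁅l, l'⁆, (n : L)⁆ - (⁅l, ⁅l', (n : L)⁆⁆ - ⁅l', ⁅l, (n : L)⁆⁆) = 0
        rw [lie_lie, sub_self]
      | lie_right l n n' =>
        simp only [map_sub, FreeLieAlgebra.lift_of_apply, idealAct_apply]
        change ⁅l, ⁅(n : L), (n' : L)⁆⁆ - (⁅⁅(n' : L), l⁆, (n : L)⁆ - ⁅⁅(n : L), l⁆, (n' : L)⁆) = 0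
        rw [leibniz_lie l (n : L) (n' : L), ← lie_skew l (n : L), neg_lie,
          ← lie_skew (n : L) ⁅l, (n' : L)⁆, ← lie_skew l (n' : L), neg_lie]
        abel
      | lie_lie l l' n n' =>
        simp only [map_sub, map_neg, LieHom.map_lie, FreeLieAlgebra.lift_of_apply,
          idealAct_apply]
        change ⁅⁅l, (n : L)⁆, ⁅l', (n' : L)⁆⁆ - (-⁅⁅(n : L), l⁆, ⁅l', (n' : L)⁆⁆) = 0
        rw [← lie_skew l (n : L), neg_lie, sub_self])

theorem kappa_tmul (N : LieIdeal F L) (l : L) (n : N) :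
    kappa N (tmul (actOnIdeal N) (idealAct N) l n) = ⁅l, (n : L)⁆ :=
  (quotLift_mk _ _ _ _).trans (by simp)

/-- `J₂(L, N)`, the kernel of `κ`. -/
def J₂ (N : LieIdeal F L) : LieIdeal F (PairTensor N) := (kappa N).ker

/-- The diagonal ideal `L □ N` of `L ⊗ N`, generated by the elements `n ⊗ n` with `n ∈ N`. -/
def diagonal (N : LieIdeal F L) : LieIdeal F (PairTensor N) :=
  LieSubmodule.lieSpan F (PairTensor N)
    {t | ∃ n : N, t = tmul (actOnIdeal N) (idealAct N) (n : L) n}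

/-- The nonabelian exterior product `L ∧ N = (L ⊗ N) / (L □ N)`. -/
abbrev PairExterior (N : LieIdeal F L) : Type _ := PairTensor N ⧸ diagonal N

/-- The commutator map `κ' : L ∧ N → L`, `l ∧ n ↦ [l, n]`. -/
def kappa' (N : LieIdeal F L) : PairExterior N →ₗ⁅F⁆ L :=
  quotLift (diagonal N) (kappa N) (by
    rw [diagonal, LieSubmodule.lieSpan_le]
    rintro x ⟨n, rfl⟩
    rw [SetLike.mem_coe, LieHom.mem_ker, kappa_tmul, lie_self])

/-- The Schur multiplier `M(L, N)` of the pair `(L, N)`, as the kernel of `κ'`. -/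
def schurMultiplier (N : LieIdeal F L) : LieIdeal F (PairExterior N) := (kappa' N).ker

/-- The abelian Lie algebra `N / [N, L]`. -/
abbrev Coinv (N : LieIdeal F L) : Type _ :=
  N ⧸ LieIdeal.comap N.incl ⁅N, (⊤ : LieIdeal F L)⁆

end Pair

end LiePair

end

/-!
For nonzero `x ∈ L₁` and `y ∈ L₂` the bracket `⁅x, y⁆` in `L₁ * L₂` is not zero. To see this one
lets `L₁` and `L₂` act on two copies of a module on which every nonzero element acts nontrivially;
such a module, of functions on the words in a basis of the Lie algebra, comes from straightening
words as in the Poincaré–Birkhoff–Witt theorem. Applied to `L₁ / N₁` and `L₂`, or to `L₁` and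
`L₂ / N₂`, this shows that `N₁ * N₂` can only be an ideal if `N₁ = L₁` and `N₂ = L₂`, or if
`L₁ * L₂` and `N₁ * N₂` both reduce to one factor, or if `N₁ = N₂ = 0`. In the last two cases the
isomorphisms are evident.

There remains the tensor square of `G = L₁ * L₂`. A linear map `P` on `G ⊗ G` that kills all
`x ⊗ x` defines a 2-cocycle on `G` with trivial coefficients. If `P` also kills the tensor squares
of the factors, then both factors lift to the corresponding central extension of `G`, hence so does
`G`. The cocycle is thus a coboundary, and `P` factors through the commutator map. Applied to the
difference between the identity and explicit projections, this computes the kernel of the commutator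
map on `G ⊗ G` and on `G ∧ G`. As for the diagonal ideal, `x ⊗ x` depends only on the class of `x`
in the abelianization, which is the same for `L₁ * L₂` and `L₁ ⊕ L₂`.
-/

noncomputable section

namespace LiePair

universe u v w z

section SwapCocycle

variable {ι V : Type*} [LinearOrder ι] [AddCommGroup V]

/-- A system of increments along the adjacent transpositions `u a b v ⟶ u b a v` of words that
satisfies the Coxeter relations of the symmetric groups, so that the total increment between two
orderings of the same letters does not depend on the path of transpositions. -/
structure IsSwapCocycle (D : List ι → ι → ι → List ι → V) : Prop where
  self : ∀ u a v, D u a a v = 0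
  skew : ∀ u a b v, D u b a v = -D u a b v
  comm : ∀ u a b v c d w, D u a b (v ++ c :: d :: w) + D (u ++ b :: a :: v) c d w =
    D (u ++ a :: b :: v) c d w + D u a b (v ++ d :: c :: w)
  braid : ∀ u a b c v, D u a b (c :: v) + D (u ++ [b]) a c v + D u b c (a :: v) =
    D (u ++ [a]) b c v + D u a c (b :: v) + D (u ++ [c]) a b v

variable (D : List ι → ι → ι → List ι → V)

/-- The total increment when `x` is inserted into a word standing to its right. -/
def insertIncr (u : List ι) (x : ι) : List ι → V
  | [] => 0
  | y :: t => if x ≤ y then 0 else D u x y t + insertIncr (u ++ [y]) x t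

/-- The total increment when a word is sorted by insertion. -/
def sortIncr (u : List ι) : List ι → V
  | [] => 0
  | x :: t => sortIncr (u ++ [x]) t + insertIncr D u x (t.insertionSort (· ≤ ·))

theorem insertIncr_nil (u : List ι) (x : ι) : insertIncr D u x [] = 0 := rfl

theorem insertIncr_of_le (u : List ι) {x y : ι} (t : List ι) (h : x ≤ y) :
    insertIncr D u x (y :: t) = 0 := by
  rw [insertIncr, if_pos h]

theorem insertIncr_of_lt (u : List ι) {x y : ι} (t : List ι) (h : y < x) :
    insertIncr D u x (y :: t) = D u x y t + insertIncr D (u ++ [y]) x t := by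
  rw [insertIncr, if_neg (not_le.mpr h)]

theorem sortIncr_nil (u : List ι) : sortIncr D u [] = 0 := rfl

theorem sortIncr_cons (u : List ι) (x : ι) (t : List ι) :
    sortIncr D u (x :: t) =
      sortIncr D (u ++ [x]) t + insertIncr D u x (t.insertionSort (· ≤ ·)) := rfl

variable {D}

theorem IsSwapCocycle.insertIncr_comm (hD : IsSwapCocycle D) (p : List ι) (a c x : ι)
    (t : List ι) : ∀ q : List ι, D p a c (q ++ x :: t) + insertIncr D (p ++ c :: a :: q) x t =
      insertIncr D (p ++ a :: c :: q) x t + D p a c (q ++ t.orderedInsert (· ≤ ·) x) := by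
  induction t with
  | nil => intro q; simp [insertIncr_nil]
  | cons y t ih =>
    intro q
    rcases le_or_gt x y with h | h
    · rw [insertIncr_of_le _ _ _ h, insertIncr_of_le _ _ _ h, List.orderedInsert_cons_of_le _ _ h]
      abel
    · rw [insertIncr_of_lt _ _ _ h, insertIncr_of_lt _ _ _ h,
        List.orderedInsert_of_not_le _ _ h.not_ge, ← add_assoc, hD.comm]
      have := ih (q ++ [y])
      simp only [List.append_assoc, List.cons_append, List.nil_append] at this ⊢
      rw [add_assoc, this]
      abel

theorem IsSwapCocycle.sortIncr_comm (hD : IsSwapCocycle D) (p : List ι) (a b : ι)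
    (v : List ι) : ∀ q : List ι, D p a b (q ++ v) + sortIncr D (p ++ b :: a :: q) v =
      sortIncr D (p ++ a :: b :: q) v + D p a b (q ++ v.insertionSort (· ≤ ·)) := by
  induction v with
  | nil => intro q; simp [sortIncr_nil]
  | cons x t ih =>
    intro q
    have h₁ := ih (q ++ [x])
    have h₂ := hD.insertIncr_comm p a b x (t.insertionSort (· ≤ ·)) q
    simp only [List.append_assoc, List.cons_append, List.nil_append] at h₁
    rw [sortIncr_cons, sortIncr_cons, List.insertionSort_cons]
    simp only [List.append_assoc, List.cons_append]
    rw [← add_assoc, h₁, add_assoc, h₂]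
    abel

theorem IsSwapCocycle.insertIncr_swap_of_le (hD : IsSwapCocycle D) {a b : ι} (hab : a ≤ b)
    (s : List ι) : ∀ p : List ι,
    insertIncr D (p ++ [a]) b s + insertIncr D p a (s.orderedInsert (· ≤ ·) b) =
      D p a b s + insertIncr D (p ++ [b]) a s +
        insertIncr D p b (s.orderedInsert (· ≤ ·) a) := by
  rcases hab.eq_or_lt with rfl | hlt
  · intro p; rw [hD.self]; abel
  induction s with
  | nil =>
    intro p
    simp only [List.orderedInsert_nil, insertIncr_nil]
    rw [insertIncr_of_le _ _ _ hab, insertIncr_of_lt _ _ _ hlt, insertIncr_nil, hD.skew]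
    abel
  | cons c s ih =>
    intro p
    rcases le_or_gt a c with hac | hac
    · rw [List.orderedInsert_cons_of_le _ _ hac, insertIncr_of_le _ (p ++ [b]) _ hac,
        insertIncr_of_lt _ _ _ hlt, hD.skew p a b]
      rcases le_or_gt b c with hbc | hbc
      · rw [List.orderedInsert_cons_of_le _ _ hbc, insertIncr_of_le _ p _ hab]
        abel
      · rw [List.orderedInsert_of_not_le _ _ hbc.not_ge, insertIncr_of_le _ p _ hac]
        abel
    · have hbc := hac.trans hlt
      rw [List.orderedInsert_of_not_le _ _ hac.not_ge, List.orderedInsert_of_not_le _ _ hbc.not_ge]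
      rw [insertIncr_of_lt _ _ _ hbc, insertIncr_of_lt _ _ _ hac, insertIncr_of_lt _ _ _ hac,
        insertIncr_of_lt _ _ _ hbc]
      have h₁ := ih (p ++ [c])
      have h₂ := hD.insertIncr_comm p a c b s []
      have h₃ := hD.insertIncr_comm p b c a s []
      have h₄ := hD.braid p a b c s
      simp only [List.append_assoc, List.cons_append, List.nil_append] at h₁ h₂ h₃ h₄ ⊢
      linear_combination (norm := module) h₁ + h₃ - h₂ - h₄

theorem IsSwapCocycle.insertIncr_swap (hD : IsSwapCocycle D) (a b : ι) (s p : List ι) :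
    insertIncr D (p ++ [a]) b s + insertIncr D p a (s.orderedInsert (· ≤ ·) b) =
      D p a b s + insertIncr D (p ++ [b]) a s +
        insertIncr D p b (s.orderedInsert (· ≤ ·) a) := by
  rcases le_total a b with h | h
  · exact hD.insertIncr_swap_of_le h s p
  · have := hD.insertIncr_swap_of_le h s p
    rw [add_assoc (D p a b s), this, hD.skew p a b]
    abel

theorem IsSwapCocycle.sortIncr_swap (hD : IsSwapCocycle D) (a b : ι) (v u : List ι) :
    ∀ p : List ι, sortIncr D p (u ++ a :: b :: v) =
      sortIncr D p (u ++ b :: a :: v) + D (p ++ u) a b v := by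
  induction u with
  | nil =>
    intro p
    simp only [List.nil_append, List.append_nil, sortIncr_cons, List.insertionSort_cons]
    have h₁ := hD.sortIncr_comm p a b v []
    have h₂ := hD.insertIncr_swap a b (v.insertionSort (· ≤ ·)) p
    simp only [List.append_assoc, List.cons_append, List.nil_append] at h₁ ⊢
    rw [add_assoc, h₂]
    linear_combination (norm := module) -h₁
  | cons x u ih =>
    intro p
    have hs : (u ++ a :: b :: v).insertionSort (· ≤ ·) =
        (u ++ b :: a :: v).insertionSort (· ≤ ·) := by
      refine List.Perm.eq_of_pairwise' (List.pairwise_insertionSort _ _)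
        (List.pairwise_insertionSort _ _) ?_
      exact (List.perm_insertionSort _ _).trans
        (((List.Perm.swap b a v).append_left u).trans (List.perm_insertionSort _ _).symm)
    simp only [List.cons_append, sortIncr_cons]
    rw [ih, hs]
    simp only [List.append_assoc, List.cons_append, List.nil_append]
    abel

end SwapCocycle

section Words

variable {F L ι W : Type*} [Field F] [LieRing L] [LieAlgebra F L] [AddCommGroup W] [Module F W]
  (b : Module.Basis ι F L)

/-- The value at `u x v`, for an element `x` of `L`, of a function on the words in a basis of `L`
that is extended linearly in one letter. -/
def letterEval (f : List ι → W) (u v : List ι) : L →ₗ[F] W :=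
  b.constr F fun k => f (u ++ k :: v)

theorem letterEval_basis (f : List ι → W) (u v : List ι) (k : ι) :
    letterEval b f u v (b k) = f (u ++ k :: v) :=
  b.constr_basis F _ k

theorem letterEval_add (f g : List ι → W) (u v : List ι) :
    letterEval b (f + g) u v = letterEval b f u v + letterEval b g u v :=
  map_add (b.constr F) (fun k => f (u ++ k :: v)) fun k => g (u ++ k :: v)

theorem letterEval_smul (c : F) (f : List ι → W) (u v : List ι) :
    letterEval b (c • f) u v = c • letterEval b f u v :=
  map_smul (b.constr F) c fun k => f (u ++ k :: v)

theorem letterEval_zero (u v : List ι) : letterEval b (0 : List ι → W) u v = 0 :=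
  map_zero (b.constr F)

/-- The value at `u x v y w`, for elements `x` and `y` of `L`, of a function on the words in a basis
of `L` that is extended linearly in two letters. -/
def twoLetterEval (f : List ι → W) (u v w : List ι) : L →ₗ[F] L →ₗ[F] W :=
  b.constr F fun k => letterEval b f (u ++ k :: v) w

theorem twoLetterEval_basis_left (f : List ι → W) (u v w : List ι) (k : ι) (y : L) :
    twoLetterEval b f u v w (b k) y = letterEval b f (u ++ k :: v) w y := by
  rw [twoLetterEval, b.constr_basis]

theorem twoLetterEval_basis_right (f : List ι → W) (u v w : List ι) (x : L) (l : ι) :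
    twoLetterEval b f u v w x (b l) = letterEval b f u (v ++ l :: w) x := by
  have : (twoLetterEval b f u v w).flip (b l) = letterEval b f u (v ++ l :: w) :=
    b.ext fun k => by simp [twoLetterEval_basis_left, letterEval_basis]
  exact LinearMap.congr_fun this x

theorem letterEval_letterEval (f : List ι → W) (u v w : List ι) (x y : L) :
    letterEval b (fun s => letterEval b f (s ++ v) w y) u [] x = twoLetterEval b f u v w x y := by
  have : letterEval b (fun s => letterEval b f (s ++ v) w y) u [] =
      (twoLetterEval b f u v w).flip y :=
    b.ext fun k => by simp [twoLetterEval_basis_left, letterEval_basis]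
  exact LinearMap.congr_fun this x

/-- The relation `u a b v - u b a v = u [a, b] v` of the enveloping algebra between functions on
words. The two sides concern words of different lengths, and are here values of two functions, so
that a function can be built up one length at a time. -/
def StraightensTo (f' f : List ι → W) : Prop :=
  ∀ (u : List ι) (i j : ι) (v : List ι),
    f' (u ++ i :: j :: v) - f' (u ++ j :: i :: v) = letterEval b f u v ⁅b i, b j⁆

variable {b}

namespace StraightensTo

variable {f' f : List ι → W}

theorem letterEval_swap (hf : StraightensTo b f' f) (u v : List ι) (x : L) (c : ι) :
    letterEval b f' u (c :: v) x - letterEval b f' (u ++ [c]) v x =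
      letterEval b f u v ⁅x, b c⁆ := by
  have : letterEval b f' u (c :: v) - letterEval b f' (u ++ [c]) v =
      letterEval b f u v ∘ₗ (-(LieModule.toEnd F L L (b c) : L →ₗ[F] L)) :=
    b.ext fun k => by
      have := hf u k c v
      rw [← lie_skew (b k), map_neg] at this
      simpa [letterEval_basis] using this
  rw [← lie_skew x, map_neg]
  simpa using LinearMap.congr_fun this x

theorem letterEval_swap_right (hf : StraightensTo b f' f) (u v w : List ι) (x : L) (i j : ι) :
    letterEval b f' u (v ++ i :: j :: w) x - letterEval b f' u (v ++ j :: i :: w) x =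
      twoLetterEval b f u v w x ⁅b i, b j⁆ := by
  have : letterEval b f' u (v ++ i :: j :: w) - letterEval b f' u (v ++ j :: i :: w) =
      (twoLetterEval b f u v w).flip ⁅b i, b j⁆ :=
    b.ext fun k => by
      simpa [letterEval_basis, twoLetterEval_basis_left] using hf (u ++ k :: v) i j w
  exact LinearMap.congr_fun this x

theorem letterEval_swap_left (hf : StraightensTo b f' f) (u v w : List ι) (x : L) (i j : ι) :
    letterEval b f' (u ++ i :: j :: v) w x - letterEval b f' (u ++ j :: i :: v) w x =
      twoLetterEval b f u v w ⁅b i, b j⁆ x := by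
  have : letterEval b f' (u ++ i :: j :: v) w - letterEval b f' (u ++ j :: i :: v) w =
      twoLetterEval b f u v w ⁅b i, b j⁆ :=
    b.ext fun k => by
      simpa [letterEval_basis, twoLetterEval_basis_right] using hf u i j (v ++ k :: w)
  exact LinearMap.congr_fun this x

/-- The braid relation is the Jacobi identity. -/
theorem isSwapCocycle (hf : StraightensTo b f' f) :
    IsSwapCocycle fun u i j v => letterEval b f' u v ⁅b i, b j⁆ where
  self u i v := by rw [lie_self, map_zero]
  skew u i j v := by rw [← lie_skew, map_neg]
  comm u i j v c d w := by
    have hright := hf.letterEval_swap_right u v w ⁅b i, b j⁆ c d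
    have hleft := hf.letterEval_swap_left u v w ⁅b c, b d⁆ i j
    linear_combination (norm := module) hright - hleft
  braid u i j k v := by
    have hjacobi : ⁅⁅b i, b j⁆, b k⁆ - ⁅⁅b i, b k⁆, b j⁆ + ⁅⁅b j, b k⁆, b i⁆ = 0 := by
      rw [lie_lie, ← lie_skew _ (b j), ← lie_skew _ (b i)]
      abel
    have heval := congrArg (letterEval b f u v) hjacobi
    rw [map_add, map_sub, map_zero] at heval
    linear_combination (norm := module) heval + hf.letterEval_swap u v ⁅b i, b j⁆ k -
      hf.letterEval_swap u v ⁅b i, b k⁆ j + hf.letterEval_swap u v ⁅b j, b k⁆ i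

theorem letterEval_nil {f : List ι → W} (hf : StraightensTo b f f) (x : L) :
    StraightensTo b (fun s => letterEval b f s [] x) fun s => letterEval b f s [] x :=
  fun u i j v => by
    have heval : letterEval b (fun s => letterEval b f s [] x) u v ⁅b i, b j⁆ =
        twoLetterEval b f u v [] ⁅b i, b j⁆ x := by
      rw [← letterEval_letterEval]
      simp [letterEval]
    rw [heval, ← hf.letterEval_swap_left]

theorem letterEval_lie {f : List ι → W} (hf : StraightensTo b f f) (u : List ι) (x y : L) :
    letterEval b f u [] ⁅x, y⁆ =
      letterEval b (fun s => letterEval b f s [] y) u [] x -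
        letterEval b (fun s => letterEval b f s [] x) u [] y := by
  have hbasis : (LieModule.toEnd F L L : L →ₗ[F] L →ₗ[F] L).compr₂ (letterEval b f u []) =
      twoLetterEval b f u [] [] - (twoLetterEval b f u [] []).flip :=
    b.ext fun i => b.ext fun j => by
      simpa [letterEval_basis, twoLetterEval_basis_left] using (hf u i j []).symm
  simpa [← letterEval_letterEval] using LinearMap.congr_fun₂ hbasis x y

end StraightensTo

variable (b) (g : ι → W)

/-- The functions on words that respect the Lie bracket, extend `g` and vanish on the sorted words
of length other than one are determined by straightening. The stage `n` is the part of such a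
function that lives on the words of length `n + 1`. -/
def wordStage [LinearOrder ι] : ℕ → List ι → W
  | 0, [i] => g i
  | 0, _ => 0
  | n + 1, w => sortIncr (fun u i j v => letterEval b (wordStage n) u v ⁅b i, b j⁆) [] w

theorem wordStage_straightensTo_zero [LinearOrder ι] :
    StraightensTo b (wordStage b g 0) (0 : List ι → W) := fun u i j v => by
  rw [letterEval_zero]
  rcases u with _ | ⟨_, _ | ⟨_, _⟩⟩ <;> simp [wordStage]

theorem wordStage_straightensTo [LinearOrder ι] (n : ℕ) :
    StraightensTo b (wordStage b g (n + 1)) (wordStage b g n) := fun u i j v => by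
  obtain ⟨f, hf⟩ : ∃ f : List ι → W, StraightensTo b (wordStage b g n) f := by
    cases n with
    | zero => exact ⟨0, wordStage_straightensTo_zero b g⟩
    | succ n => exact ⟨_, wordStage_straightensTo n⟩
  simp only [wordStage]
  rw [hf.isSwapCocycle.sortIncr_swap, List.nil_append, add_sub_cancel_left]

/-- A function on words that respects the Lie bracket and extends `g`. -/
def wordExtend [LinearOrder ι] (w : List ι) : W := wordStage b g (w.length - 1) w

theorem wordExtend_singleton [LinearOrder ι] (i : ι) : wordExtend b g [i] = g i := rfl

theorem wordExtend_straightensTo [LinearOrder ι] :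
    StraightensTo b (wordExtend b g) (wordExtend b g) := fun u i j v => by
  have heval : letterEval b (wordExtend b g) u v =
      letterEval b (wordStage b g (u.length + v.length)) u v :=
    b.ext fun k => by simp [letterEval_basis, wordExtend, ← add_assoc]
  rw [heval, ← wordStage_straightensTo b g (u.length + v.length) u i j v]
  simp [wordExtend, ← add_assoc]

end Words

section Representation

attribute [local instance] LieRing.ofAssociativeRing

variable {F L ι : Type*} [Field F] [LieRing L] [LieAlgebra F L] (b : Module.Basis ι F L)
  (W : Type*) [AddCommGroup W] [Module F W]

/-- The functions on words in a basis of `L` that respect the Lie bracket; they are the linear maps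
from the enveloping algebra of `L` to `W`. -/
def wordModule : Submodule F (List ι → W) where
  carrier := {f | StraightensTo b f f}
  zero_mem' u i j v := by simp [letterEval_zero]
  add_mem' {f g} hf hg u i j v := by
    rw [letterEval_add, LinearMap.add_apply, ← hf, ← hg]
    exact add_sub_add_comm _ _ _ _
  smul_mem' c f hf u i j v := by
    rw [letterEval_smul, LinearMap.smul_apply, ← hf]
    exact (smul_sub c (f _) (f _)).symm

/-- The action of `L` on functions on words by right translation. -/
def wordAction : L →ₗ⁅F⁆ Module.End F (wordModule b W) where
  toFun x :=
    { toFun := fun f => ⟨fun u => letterEval b f.1 u [] x, StraightensTo.letterEval_nil f.2 x⟩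
      map_add' := fun f g => Subtype.ext <| funext fun u =>
        LinearMap.congr_fun (letterEval_add b f.1 g.1 u []) x
      map_smul' := fun c f => Subtype.ext <| funext fun u =>
        LinearMap.congr_fun (letterEval_smul b c f.1 u []) x }
  map_add' x y := LinearMap.ext fun f => Subtype.ext <| funext fun u =>
    map_add (letterEval b f.1 u []) x y
  map_smul' c x := LinearMap.ext fun f => Subtype.ext <| funext fun u =>
    map_smul (letterEval b f.1 u []) c x
  map_lie' {x y} := LinearMap.ext fun f => Subtype.ext <| funext fun u =>
    StraightensTo.letterEval_lie f.2 u x y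

theorem exists_representation_ne_zero {F : Type u} {L : Type v} [Field F] [LieRing L]
    [LieAlgebra F L] {x : L} (hx : x ≠ 0) :
    ∃ (V : Type v) (_ : AddCommGroup V) (_ : Module F V) (ρ : L →ₗ⁅F⁆ Module.End F V),
      ρ x ≠ 0 := by
  let b := Module.Free.chooseBasis F L
  let _ : LinearOrder (Module.Free.ChooseBasisIndex F L) := IsWellOrder.linearOrder WellOrderingRel
  refine ⟨wordModule b L, inferInstance, inferInstance, wordAction b L, fun h => hx ?_⟩
  have hzero : letterEval b (wordExtend b b) [] [] x = 0 :=
    congrArg (fun f : wordModule b L => f.1 [])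
      (LinearMap.congr_fun h ⟨wordExtend b b, wordExtend_straightensTo b b⟩)
  have hid : letterEval b (wordExtend b b) [] [] = LinearMap.id :=
    b.ext fun k => by simp [letterEval_basis, wordExtend_singleton]
  rwa [hid] at hzero

end Representation

section FreeProduct

attribute [local instance] LieRing.ofAssociativeRing

variable {F : Type u} {L₁ : Type v} {L₂ : Type w} [Field F] [LieRing L₁] [LieAlgebra F L₁]
  [LieRing L₂] [LieAlgebra F L₂] {M : Type z} [LieRing M] [LieAlgebra F M]

theorem quotMk_surjective (I : LieIdeal F L₁) : Function.Surjective (quotMk I) :=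
  LieSubmodule.Quotient.surjective_mk' I

theorem quotMk_eq_zero {I : LieIdeal F L₁} {x : L₁} : quotMk I x = 0 ↔ x ∈ I :=
  LieSubmodule.Quotient.mk_eq_zero'

theorem quot_hom_ext {I : LieIdeal F L₁} {f g : L₁ ⧸ I →ₗ⁅F⁆ M}
    (h : ∀ x, f (quotMk I x) = g (quotMk I x)) : f = g :=
  LieHom.ext fun x => by
    obtain ⟨x, rfl⟩ := quotMk_surjective I x
    exact h x

/-- A morphism of Lie algebras with values in a subalgebra, as a morphism to the subalgebra. -/
def lieCodRestrict (S : LieSubalgebra F M) (f : L₁ →ₗ⁅F⁆ M) (h : ∀ x, f x ∈ S) : L₁ →ₗ⁅F⁆ S :=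
  { (f : L₁ →ₗ[F] M).codRestrict S.toSubmodule h with
    map_lie' := fun {x y} => Subtype.ext (f.map_lie x y) }

theorem coe_lieCodRestrict_apply (S : LieSubalgebra F M) (f : L₁ →ₗ⁅F⁆ M) (h : ∀ x, f x ∈ S)
    (x : L₁) : (lieCodRestrict S f h x : M) = f x := rfl

namespace FreeProd

theorem hom_ext {f g : FreeProd F L₁ L₂ →ₗ⁅F⁆ M} (h₁ : ∀ x, f (inl F L₁ L₂ x) = g (inl F L₁ L₂ x))
    (h₂ : ∀ x, f (inr F L₁ L₂ x) = g (inr F L₁ L₂ x)) : f = g :=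
  quot_hom_ext <| LieHom.congr_fun <| FreeLieAlgebra.hom_ext (F₁ := f.comp (quotMk _))
    (F₂ := g.comp (quotMk _)) fun x => x.rec h₁ h₂

theorem lift_mem {S : LieSubalgebra F M} {f : L₁ →ₗ⁅F⁆ M} {g : L₂ →ₗ⁅F⁆ M} (hf : ∀ x, f x ∈ S)
    (hg : ∀ x, g x ∈ S) (t : FreeProd F L₁ L₂) : lift f g t ∈ S := by
  have hfactor : S.incl.comp (lift (lieCodRestrict S f hf) (lieCodRestrict S g hg)) = lift f g :=
    hom_ext (fun x => by simp [lift_inl, coe_lieCodRestrict_apply])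
      fun x => by simp [lift_inr, coe_lieCodRestrict_apply]
  rw [← hfactor]
  exact Subtype.coe_prop _

theorem lift_inl_inr : lift (inl F L₁ L₂) (inr F L₁ L₂) = LieHom.id :=
  hom_ext (fun x => by simp [lift_inl]) fun x => by simp [lift_inr]

theorem mem_of_inl_mem_of_inr_mem {S : LieSubalgebra F (FreeProd F L₁ L₂)}
    (h₁ : ∀ x, inl F L₁ L₂ x ∈ S) (h₂ : ∀ x, inr F L₁ L₂ x ∈ S) (t : FreeProd F L₁ L₂) : t ∈ S := by
  rw [← LieHom.id_apply (R := F) t, ← lift_inl_inr]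
  exact lift_mem h₁ h₂ t

end FreeProd

/-- The representation of `L` on a space `E` induced by a representation on a retract `V` of `E`;
it annihilates the kernel of the retraction. -/
def retractRep {V E : Type*} [AddCommGroup V] [Module F V] [AddCommGroup E] [Module F E]
    (ρ : L₁ →ₗ⁅F⁆ Module.End F V) (i : V →ₗ[F] E) (p : E →ₗ[F] V) (h : p ∘ₗ i = LinearMap.id) :
    L₁ →ₗ⁅F⁆ Module.End F E where
  toFun x := i ∘ₗ ρ x ∘ₗ p
  map_add' x y := by ext; simp
  map_smul' c x := by ext; simp
  map_lie' {x y} := by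
    have hp (v : V) : p (i v) = v := LinearMap.congr_fun h v
    ext
    simp [Ring.lie_def, hp]

theorem retractRep_apply {V E : Type*} [AddCommGroup V] [Module F V] [AddCommGroup E] [Module F E]
    (ρ : L₁ →ₗ⁅F⁆ Module.End F V) (i : V →ₗ[F] E) (p : E →ₗ[F] V) (h : p ∘ₗ i = LinearMap.id)
    (x : L₁) (e : E) : retractRep ρ i p h x e = i (ρ x (p e)) := rfl

/-- Let `L₁` act on the first factor of `V₁ × V₂`, and let `L₂` act on the second one through a
projection that is twisted so as to send `x v₁` to a vector `v₂` with `y v₂ ≠ 0`. -/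
theorem FreeProd.lie_inl_inr_ne_zero {x : L₁} {y : L₂} (hx : x ≠ 0) (hy : y ≠ 0) :
    ⁅inl F L₁ L₂ x, inr F L₁ L₂ y⁆ ≠ 0 := by
  obtain ⟨V₁, _, _, ρ₁, hρ₁⟩ := exists_representation_ne_zero (F := F) hx
  obtain ⟨V₂, _, _, ρ₂, hρ₂⟩ := exists_representation_ne_zero (F := F) hy
  obtain ⟨v₁, hv₁⟩ := DFunLike.ne_iff.mp hρ₁
  obtain ⟨v₂, hv₂⟩ := DFunLike.ne_iff.mp hρ₂
  obtain ⟨φ, hφ⟩ := Module.Projective.exists_dual_eq_one F hv₁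
  let f₁ := retractRep ρ₁ (LinearMap.inl F V₁ V₂) (LinearMap.fst F V₁ V₂) (by ext; simp)
  let f₂ := retractRep ρ₂ (LinearMap.inr F V₁ V₂)
    (φ.smulRight v₂ ∘ₗ LinearMap.fst F V₁ V₂ + LinearMap.snd F V₁ V₂) (by ext; simp)
  intro h
  have h₀ := congrArg (fun t => lift f₁ f₂ t (v₁, 0)) h
  exact hv₂ (by simpa [lift_inl, lift_inr, Ring.lie_def, f₁, f₂, retractRep_apply, hφ] using h₀)

section Ideals

variable {N₁ : LieIdeal F L₁} {N₂ : LieIdeal F L₂} {N : LieIdeal F (FreeProd F L₁ L₂)}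

theorem freeProdSubalgebra_le {S : LieSubalgebra F (FreeProd F L₁ L₂)}
    (h₁ : ∀ x ∈ N₁, FreeProd.inl F L₁ L₂ x ∈ S) (h₂ : ∀ y ∈ N₂, FreeProd.inr F L₁ L₂ y ∈ S) :
    freeProdSubalgebra N₁ N₂ ≤ S := by
  rintro _ ⟨t, rfl⟩
  exact FreeProd.lift_mem (fun x : N₁ => h₁ x x.2) (fun y : N₂ => h₂ y y.2) t

theorem inl_mem_freeProdSubalgebra {x : L₁} (hx : x ∈ N₁) :
    FreeProd.inl F L₁ L₂ x ∈ freeProdSubalgebra N₁ N₂ :=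
  ⟨FreeProd.inl F N₁ N₂ ⟨x, hx⟩, FreeProd.lift_inl _ _ _⟩

theorem inr_mem_freeProdSubalgebra {y : L₂} (hy : y ∈ N₂) :
    FreeProd.inr F L₁ L₂ y ∈ freeProdSubalgebra N₁ N₂ :=
  ⟨FreeProd.inr F N₁ N₂ ⟨y, hy⟩, FreeProd.lift_inr _ _ _⟩

theorem inl_mem (hN : N.toLieSubalgebra = freeProdSubalgebra N₁ N₂) {x : L₁} (hx : x ∈ N₁) :
    FreeProd.inl F L₁ L₂ x ∈ N :=
  hN.ge (inl_mem_freeProdSubalgebra hx)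

theorem inr_mem (hN : N.toLieSubalgebra = freeProdSubalgebra N₁ N₂) {y : L₂} (hy : y ∈ N₂) :
    FreeProd.inr F L₁ L₂ y ∈ N :=
  hN.ge (inr_mem_freeProdSubalgebra hy)

theorem FreeProd.lie_inl_inr_notMem_range_inl {x : L₁} {y : L₂} (hx : x ≠ 0) (hy : y ≠ 0) :
    ⁅inl F L₁ L₂ x, inr F L₁ L₂ y⁆ ∉ (inl F L₁ L₂).range := by
  intro h
  obtain ⟨z, hz⟩ := LieHom.mem_range _ _ |>.mp h
  have hz₀ := congrArg (lift (LieHom.id : L₁ →ₗ⁅F⁆ L₁) 0) hz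
  simp only [LieHom.map_lie, lift_inl, lift_inr, LieHom.id_apply, LieHom.zero_apply,
    lie_zero] at hz₀
  exact lie_inl_inr_ne_zero hx hy (by rw [← hz, hz₀, map_zero])

theorem FreeProd.lie_inl_inr_notMem_range_inr {x : L₁} {y : L₂} (hx : x ≠ 0) (hy : y ≠ 0) :
    ⁅inl F L₁ L₂ x, inr F L₁ L₂ y⁆ ∉ (inr F L₁ L₂).range := by
  intro h
  obtain ⟨z, hz⟩ := LieHom.mem_range _ _ |>.mp h
  have hz₀ := congrArg (lift 0 (LieHom.id : L₂ →ₗ⁅F⁆ L₂)) hz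
  simp only [LieHom.map_lie, lift_inl, lift_inr, LieHom.id_apply, LieHom.zero_apply,
    zero_lie] at hz₀
  exact lie_inl_inr_ne_zero hx hy (by rw [← hz, hz₀, map_zero])

theorem right_eq_top_of_left_ne_bot (hN : N.toLieSubalgebra = freeProdSubalgebra N₁ N₂)
    (h : N₁ ≠ ⊥) : N₂ = ⊤ := by
  obtain ⟨x, hx, hx₀⟩ : ∃ x ∈ N₁, x ≠ 0 := by simpa [LieSubmodule.eq_bot_iff] using h
  refine eq_top_iff.mpr fun y _ => ?_
  by_contra hy
  let Φ : FreeProd F L₁ L₂ →ₗ⁅F⁆ FreeProd F L₁ (L₂ ⧸ N₂) :=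
    FreeProd.lift (FreeProd.inl F _ _) ((FreeProd.inr F _ _).comp (quotMk N₂))
  have hle : freeProdSubalgebra N₁ N₂ ≤ (FreeProd.inl F L₁ (L₂ ⧸ N₂)).range.comap Φ :=
    freeProdSubalgebra_le (fun x _ => ⟨x, (FreeProd.lift_inl _ _ x).symm⟩) fun y hy =>
      ⟨0, by simp [Φ, FreeProd.lift_inr, quotMk_eq_zero.mpr hy]⟩
  have hmem : Φ ⁅FreeProd.inl F L₁ L₂ x, FreeProd.inr F L₁ L₂ y⁆ ∈
      (FreeProd.inl F L₁ (L₂ ⧸ N₂)).range :=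
    hle (hN.le (lie_mem_left F _ N _ _ (inl_mem hN hx)))
  rw [LieHom.map_lie, FreeProd.lift_inl, FreeProd.lift_inr] at hmem
  exact FreeProd.lie_inl_inr_notMem_range_inl hx₀ (mt quotMk_eq_zero.mp hy) hmem

theorem left_eq_top_of_right_ne_bot (hN : N.toLieSubalgebra = freeProdSubalgebra N₁ N₂)
    (h : N₂ ≠ ⊥) : N₁ = ⊤ := by
  obtain ⟨y, hy, hy₀⟩ : ∃ y ∈ N₂, y ≠ 0 := by simpa [LieSubmodule.eq_bot_iff] using h
  refine eq_top_iff.mpr fun x _ => ?_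
  by_contra hx
  let Φ : FreeProd F L₁ L₂ →ₗ⁅F⁆ FreeProd F (L₁ ⧸ N₁) L₂ :=
    FreeProd.lift ((FreeProd.inl F _ _).comp (quotMk N₁)) (FreeProd.inr F _ _)
  have hle : freeProdSubalgebra N₁ N₂ ≤ (FreeProd.inr F (L₁ ⧸ N₁) L₂).range.comap Φ :=
    freeProdSubalgebra_le (fun x hx => ⟨0, by simp [Φ, FreeProd.lift_inl, quotMk_eq_zero.mpr hx]⟩)
      fun y _ => ⟨y, (FreeProd.lift_inr _ _ y).symm⟩
  have hmem : Φ ⁅FreeProd.inl F L₁ L₂ x, FreeProd.inr F L₁ L₂ y⁆ ∈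
      (FreeProd.inr F (L₁ ⧸ N₁) L₂).range :=
    hle (hN.le (lie_mem_right F _ N _ _ (inr_mem hN hy)))
  rw [LieHom.map_lie, FreeProd.lift_inl, FreeProd.lift_inr] at hmem
  exact FreeProd.lie_inl_inr_notMem_range_inr (mt quotMk_eq_zero.mp hx) hy₀ hmem

theorem subsingleton_or_bot_or_top (hN : N.toLieSubalgebra = freeProdSubalgebra N₁ N₂) :
    Subsingleton L₁ ∨ Subsingleton L₂ ∨ (N₁ = ⊥ ∧ N₂ = ⊥) ∨ (N₁ = ⊤ ∧ N₂ = ⊤) := by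
  rcases subsingleton_or_nontrivial L₁ with _ | _
  · exact .inl inferInstance
  rcases subsingleton_or_nontrivial L₂ with _ | _
  · exact .inr (.inl inferInstance)
  refine .inr (.inr ?_)
  by_cases h₁ : N₁ = ⊥
  · refine .inl ⟨h₁, by_contra fun h₂ => ?_⟩
    exact bot_ne_top (h₁.symm.trans (left_eq_top_of_right_ne_bot hN h₂))
  · have h₂ := right_eq_top_of_left_ne_bot hN h₁
    exact .inr ⟨left_eq_top_of_right_ne_bot hN (h₂ ▸ top_ne_bot), h₂⟩

end Ideals

end FreeProduct

section Tensor

variable {F : Type u} {L : Type v} {N : Type w} [Field F] [LieRing L] [LieAlgebra F L]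
  [LieRing N] [LieAlgebra F N] {φ : L →ₗ⁅F⁆ LieDerivation F N N}
  {ψ : N →ₗ⁅F⁆ LieDerivation F L L}

theorem TensorRelator.quotMk_eq_zero {x : FreeLieAlgebra F (L × N)} (h : TensorRelator φ ψ x) :
    quotMk (tensorIdeal φ ψ) x = 0 :=
  LiePair.quotMk_eq_zero.mpr (LieSubmodule.subset_lieSpan h)

theorem tmul_smul_left (c : F) (l : L) (n : N) : tmul φ ψ (c • l) n = c • tmul φ ψ l n := by
  have := (TensorRelator.smul_left (φ := φ) (ψ := ψ) c l n).quotMk_eq_zero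
  rw [map_sub, map_smul, sub_eq_zero] at this
  exact this.symm

theorem tmul_smul_right (c : F) (l : L) (n : N) : tmul φ ψ l (c • n) = c • tmul φ ψ l n := by
  have := (TensorRelator.smul_right (φ := φ) (ψ := ψ) c l n).quotMk_eq_zero
  rw [map_sub, map_smul, sub_eq_zero] at this
  exact this.symm

theorem tmul_add_left (l l' : L) (n : N) :
    tmul φ ψ (l + l') n = tmul φ ψ l n + tmul φ ψ l' n := by
  have := (TensorRelator.add_left (φ := φ) (ψ := ψ) l l' n).quotMk_eq_zero
  rw [map_sub, map_add, sub_eq_zero] at this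
  exact this

theorem tmul_add_right (l : L) (n n' : N) :
    tmul φ ψ l (n + n') = tmul φ ψ l n + tmul φ ψ l n' := by
  have := (TensorRelator.add_right (φ := φ) (ψ := ψ) l n n').quotMk_eq_zero
  rw [map_sub, map_add, sub_eq_zero] at this
  exact this

theorem tmul_lie_left (l l' : L) (n : N) :
    tmul φ ψ ⁅l, l'⁆ n = tmul φ ψ l (φ l' n) - tmul φ ψ l' (φ l n) := by
  have := (TensorRelator.lie_left (φ := φ) (ψ := ψ) l l' n).quotMk_eq_zero
  rw [map_sub, map_sub, sub_eq_zero] at this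
  exact this

theorem tmul_lie_right (l : L) (n n' : N) :
    tmul φ ψ l ⁅n, n'⁆ = tmul φ ψ (ψ n' l) n - tmul φ ψ (ψ n l) n' := by
  have := (TensorRelator.lie_right (φ := φ) (ψ := ψ) l n n').quotMk_eq_zero
  rw [map_sub, map_sub, sub_eq_zero] at this
  exact this

theorem lie_tmul_tmul (l l' : L) (n n' : N) :
    ⁅tmul φ ψ l n, tmul φ ψ l' n'⁆ = -tmul φ ψ (ψ n l) (φ l' n') := by
  have := (TensorRelator.lie_lie (φ := φ) (ψ := ψ) l l' n n').quotMk_eq_zero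
  rw [map_sub, map_neg, LieHom.map_lie, sub_eq_zero] at this
  exact this

variable (φ ψ) in
/-- The nonabelian tensor as a bilinear map. -/
def tmulₗ : L →ₗ[F] N →ₗ[F] NonabTensor φ ψ :=
  LinearMap.mk₂ F (tmul φ ψ) tmul_add_left tmul_smul_left tmul_add_right tmul_smul_right

@[simp]
theorem tmulₗ_apply (l : L) (n : N) : tmulₗ φ ψ l n = tmul φ ψ l n := rfl

@[simp]
theorem tmul_zero_left (n : N) : tmul φ ψ 0 n = 0 := by
  rw [← tmulₗ_apply, map_zero, LinearMap.zero_apply]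

@[simp]
theorem tmul_zero_right (l : L) : tmul φ ψ l 0 = 0 := by
  rw [← tmulₗ_apply, map_zero]

theorem tmul_neg_left (l : L) (n : N) : tmul φ ψ (-l) n = -tmul φ ψ l n := by
  rw [← tmulₗ_apply, map_neg, LinearMap.neg_apply, tmulₗ_apply]

theorem span_tmul : Submodule.span F {t | ∃ l n, t = tmul φ ψ l n} = ⊤ := by
  let S := Submodule.span F {t | ∃ l n, t = tmul φ ψ l n}
  have hmem (l : L) (n : N) : tmul φ ψ l n ∈ S := Submodule.subset_span ⟨l, n, rfl⟩
  have hlie : ∀ x ∈ S, ∀ y ∈ S, ⁅x, y⁆ ∈ S := fun x hx y hy =>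
    LinearMap.BilinMap.apply_apply_mem_of_mem_span S _ _
      (LieModule.toEnd F (NonabTensor φ ψ) (NonabTensor φ ψ) :
        NonabTensor φ ψ →ₗ[F] Module.End F (NonabTensor φ ψ))
      (by
        rintro _ ⟨l, n, rfl⟩ _ ⟨l', n', rfl⟩
        change ⁅tmul φ ψ l n, tmul φ ψ l' n'⁆ ∈ S
        rw [lie_tmul_tmul]
        exact S.neg_mem (hmem _ _)) x y hx hy
  let K : LieSubalgebra F (NonabTensor φ ψ) := { S with lie_mem' := fun hx hy => hlie _ hx _ hy }
  let g : FreeLieAlgebra F (L × N) →ₗ⁅F⁆ K :=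
    FreeLieAlgebra.lift F fun p => ⟨tmul φ ψ p.1 p.2, hmem _ _⟩
  have hg : K.incl.comp g = quotMk (tensorIdeal φ ψ) := FreeLieAlgebra.hom_ext fun p => by
    rw [LieHom.comp_apply, FreeLieAlgebra.lift_of_apply]
    rfl
  refine eq_top_iff.mpr fun t _ => ?_
  obtain ⟨t, rfl⟩ := quotMk_surjective _ t
  rw [← hg]
  exact (g t).2

theorem tensor_induction {p : NonabTensor φ ψ → Prop} (t : NonabTensor φ ψ)
    (tmul : ∀ l n, p (tmul φ ψ l n)) (zero : p 0) (add : ∀ x y, p x → p y → p (x + y))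
    (smul : ∀ (c : F) x, p x → p (c • x)) : p t := by
  have ht : t ∈ Submodule.span F {t | ∃ l n, t = LiePair.tmul φ ψ l n} := by
    rw [span_tmul]; trivial
  refine Submodule.span_induction ?_ zero (fun x y _ _ => add x y) (fun c x _ => smul c x) ht
  rintro _ ⟨l, n, rfl⟩
  exact tmul l n

theorem tensor_linearMap_ext {V : Type*} [AddCommGroup V] [Module F V]
    {f g : NonabTensor φ ψ →ₗ[F] V} (h : ∀ l n, f (tmul φ ψ l n) = g (tmul φ ψ l n)) : f = g :=
  LinearMap.ext fun t => tensor_induction (p := fun t => f t = g t) t h (by simp)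
    (fun x y hx hy => by rw [map_add, map_add, hx, hy])
    (fun c x hx => by rw [map_smul, map_smul, hx])

theorem subsingleton_tensor_of_left [Subsingleton L] : Subsingleton (NonabTensor φ ψ) :=
  subsingleton_of_forall_eq 0 fun t =>
    tensor_induction (p := fun t => t = 0) t
      (fun l n => by rw [Subsingleton.elim l 0, tmul_zero_left]) rfl
      (fun x y hx hy => by rw [hx, hy, add_zero]) (fun c x hx => by rw [hx, smul_zero])

theorem subsingleton_tensor_of_right [Subsingleton N] : Subsingleton (NonabTensor φ ψ) :=
  subsingleton_of_forall_eq 0 fun t =>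
    tensor_induction (p := fun t => t = 0) t
      (fun l n => by rw [Subsingleton.elim n 0, tmul_zero_right]) rfl
      (fun x y hx hy => by rw [hx, hy, add_zero]) (fun c x hx => by rw [hx, smul_zero])

variable {M : Type z} [LieRing M] [LieAlgebra F M]

variable (φ ψ) in
/-- The bilinear maps that satisfy the relations of the nonabelian tensor product. -/
structure IsLiePairing (f : L →ₗ[F] N →ₗ[F] M) : Prop where
  lie_left : ∀ l l' n, f ⁅l, l'⁆ n = f l (φ l' n) - f l' (φ l n)
  lie_right : ∀ l n n', f l ⁅n, n'⁆ = f (ψ n' l) n - f (ψ n l) n'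
  lie_lie : ∀ l l' n n', ⁅f l n, f l' n'⁆ = -f (ψ n l) (φ l' n')

/-- The universal property of the nonabelian tensor product. -/
def tensorLift (f : L →ₗ[F] N →ₗ[F] M) (hf : IsLiePairing φ ψ f) : NonabTensor φ ψ →ₗ⁅F⁆ M :=
  quotLift (tensorIdeal φ ψ) (FreeLieAlgebra.lift F fun p : L × N => f p.1 p.2) (by
    rw [tensorIdeal, LieSubmodule.lieSpan_le]
    rintro x hx
    rw [SetLike.mem_coe, LieHom.mem_ker]
    cases hx with
    | smul_left c l n => simp
    | smul_right c l n => simp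
    | add_left l l' n => simp
    | add_right l n n' => simp
    | lie_left l l' n => simp [hf.lie_left]
    | lie_right l n n' => simp [hf.lie_right]
    | lie_lie l l' n n' => simp [hf.lie_lie])

@[simp]
theorem tensorLift_tmul (f : L →ₗ[F] N →ₗ[F] M) (hf : IsLiePairing φ ψ f) (l : L) (n : N) :
    tensorLift f hf (tmul φ ψ l n) = f l n :=
  (quotLift_mk _ _ _ _).trans (by simp)

end Tensor

section Restrict

variable {F : Type u} {A : Type v} {B : Type w} [Field F] [LieRing A] [LieAlgebra F A]
  [LieRing B] [LieAlgebra F B]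

/-- The restriction of a morphism of Lie algebras to ideals. -/
def restrictIdeal (f : A →ₗ⁅F⁆ B) (I : LieIdeal F A) (J : LieIdeal F B)
    (h : ∀ x ∈ I, f x ∈ J) : I →ₗ⁅F⁆ J where
  toFun x := ⟨f x, h x x.2⟩
  map_add' x y := Subtype.ext (map_add f (x : A) (y : A))
  map_smul' c x := Subtype.ext (map_smul f c (x : A))
  map_lie' {x y} := Subtype.ext (f.map_lie (x : A) (y : A))

@[simp]
theorem restrictIdeal_coe (f : A →ₗ⁅F⁆ B) (I : LieIdeal F A) (J : LieIdeal F B)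
    (h : ∀ x ∈ I, f x ∈ J) (x : I) : (restrictIdeal f I J h x : B) = f x := rfl

end Restrict

section Functoriality

variable {F : Type u} {L : Type v} {L' : Type w} {L'' : Type z} [Field F] [LieRing L]
  [LieAlgebra F L] [LieRing L'] [LieAlgebra F L'] [LieRing L''] [LieAlgebra F L'']
  {N : LieIdeal F L} {N' : LieIdeal F L'} {N'' : LieIdeal F L''}

theorem actOnIdeal_apply_coe (N : LieIdeal F L) (l : L) (n : N) :
    (actOnIdeal N l n : L) = ⁅l, (n : L)⁆ := rfl

/-- The tensor product of pairs is functorial. -/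
def pairMap (f : L →ₗ⁅F⁆ L') (h : ∀ x ∈ N, f x ∈ N') : PairTensor N →ₗ⁅F⁆ PairTensor N' :=
  tensorLift ((tmulₗ (actOnIdeal N') (idealAct N')).compl₁₂ (f : L →ₗ[F] L')
      (restrictIdeal f N N' h : N →ₗ[F] N'))
    { lie_left := fun l l' n => by
        have e (l : L) : restrictIdeal f N N' h (actOnIdeal N l n) =
            actOnIdeal N' (f l) (restrictIdeal f N N' h n) := Subtype.ext (f.map_lie l n)
        simp [tmul_lie_left, e]
      lie_right := fun l n n' => by
        have e (n : N) : f (idealAct N n l) = idealAct N' (restrictIdeal f N N' h n) (f l) := by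
          simp [idealAct_apply]
        simp only [LinearMap.compl₁₂_apply, LieHom.coe_toLinearMap, tmulₗ_apply, e]
        rw [LieHom.map_lie, tmul_lie_right]
      lie_lie := fun l l' n n' => by
        have e₁ (l : L) : restrictIdeal f N N' h (actOnIdeal N l n') =
            actOnIdeal N' (f l) (restrictIdeal f N N' h n') := Subtype.ext (f.map_lie l n')
        have e₂ (n : N) : f (idealAct N n l) = idealAct N' (restrictIdeal f N N' h n) (f l) := by
          simp [idealAct_apply]
        simp [lie_tmul_tmul, e₁, e₂] }

@[simp]
theorem pairMap_tmul (f : L →ₗ⁅F⁆ L') (h : ∀ x ∈ N, f x ∈ N') (l : L) (n : N) :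
    pairMap f h (tmul (actOnIdeal N) (idealAct N) l n) =
      tmul (actOnIdeal N') (idealAct N') (f l) ⟨f n, h n n.2⟩ :=
  tensorLift_tmul _ _ _ _

theorem pairMap_pairMap (f : L →ₗ⁅F⁆ L') (h : ∀ x ∈ N, f x ∈ N') (g : L' →ₗ⁅F⁆ L'')
    (h' : ∀ x ∈ N', g x ∈ N'') (k : L →ₗ⁅F⁆ L'') (hk : ∀ x ∈ N, k x ∈ N'')
    (hgf : ∀ x, g (f x) = k x) (t : PairTensor N) :
    pairMap g h' (pairMap f h t) = pairMap k hk t := by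
  have : (pairMap g h' : PairTensor N' →ₗ[F] PairTensor N'') ∘ₗ
      (pairMap f h : PairTensor N →ₗ[F] PairTensor N') =
      (pairMap k hk : PairTensor N →ₗ[F] PairTensor N'') :=
    tensor_linearMap_ext fun l n => by simp [hgf]
  exact LinearMap.congr_fun this t

theorem pairMap_pairMap_eq_self (f : L →ₗ⁅F⁆ L') (h : ∀ x ∈ N, f x ∈ N') (g : L' →ₗ⁅F⁆ L)
    (h' : ∀ x ∈ N', g x ∈ N) (hgf : ∀ x, g (f x) = x) (t : PairTensor N) :
    pairMap g h' (pairMap f h t) = t := by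
  have : (pairMap g h' : PairTensor N' →ₗ[F] PairTensor N) ∘ₗ
      (pairMap f h : PairTensor N →ₗ[F] PairTensor N') = LinearMap.id :=
    tensor_linearMap_ext fun l n => by simp [hgf]
  exact LinearMap.congr_fun this t

theorem pairMap_pairMap_eq_zero (f : L →ₗ⁅F⁆ L') (h : ∀ x ∈ N, f x ∈ N') (g : L' →ₗ⁅F⁆ L'')
    (h' : ∀ x ∈ N', g x ∈ N'') (hgf : ∀ x, g (f x) = 0) (t : PairTensor N) :
    pairMap g h' (pairMap f h t) = 0 := by
  have : (pairMap g h' : PairTensor N' →ₗ[F] PairTensor N'') ∘ₗ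
      (pairMap f h : PairTensor N →ₗ[F] PairTensor N') = 0 :=
    tensor_linearMap_ext fun l n => by simp [hgf]
  exact LinearMap.congr_fun this t

theorem kappa_pairMap (f : L →ₗ⁅F⁆ L') (h : ∀ x ∈ N, f x ∈ N') (t : PairTensor N) :
    kappa N' (pairMap f h t) = f (kappa N t) := by
  have : (kappa N' : PairTensor N' →ₗ[F] L') ∘ₗ
      (pairMap f h : PairTensor N →ₗ[F] PairTensor N') =
      (f : L →ₗ[F] L') ∘ₗ (kappa N : PairTensor N →ₗ[F] L) :=
    tensor_linearMap_ext fun l n => by simp [kappa_tmul]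
  exact LinearMap.congr_fun this t

theorem mem_J₂ {t : PairTensor N} : t ∈ J₂ N ↔ kappa N t = 0 := LieHom.mem_ker

theorem pairMap_mem_J₂ (f : L →ₗ⁅F⁆ L') (h : ∀ x ∈ N, f x ∈ N') {t : PairTensor N}
    (ht : t ∈ J₂ N) : pairMap f h t ∈ J₂ N' := by
  rw [mem_J₂] at ht ⊢
  rw [kappa_pairMap, ht, map_zero]

theorem tmul_self_mem_diagonal (n : N) :
    tmul (actOnIdeal N) (idealAct N) (n : L) n ∈ diagonal N :=
  LieSubmodule.subset_lieSpan ⟨n, rfl⟩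

theorem lie_tmul_self (t : PairTensor N) (n : N) :
    ⁅t, tmul (actOnIdeal N) (idealAct N) (n : L) n⁆ = 0 := by
  refine tensor_induction (p := fun t => ⁅t, tmul (actOnIdeal N) (idealAct N) (n : L) n⁆ = 0) t
    (fun l m => ?_) (zero_lie _) (fun x y hx hy => by rw [add_lie, hx, hy, add_zero])
    fun c x hx => by rw [smul_lie, hx, smul_zero]
  rw [← lie_skew, lie_tmul_tmul, idealAct_apply, lie_self, tmul_zero_left, neg_zero, neg_zero]

theorem diagonal_eq_span : (diagonal N).toSubmodule =
    Submodule.span F {t | ∃ n : N, t = tmul (actOnIdeal N) (idealAct N) (n : L) n} := by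
  apply le_antisymm
  · let S : LieIdeal F (PairTensor N) :=
      { Submodule.span F {t | ∃ n : N, t = tmul (actOnIdeal N) (idealAct N) (n : L) n} with
        lie_mem := fun {x m} hm => by
          have hxm : ⁅x, m⁆ = 0 := by
            refine Submodule.span_induction (p := fun m _ => ⁅x, m⁆ = 0) ?_ (lie_zero x)
              (fun m m' _ _ h h' => by rw [lie_add, h, h', add_zero])
              (fun c m _ h => by rw [lie_smul, h, smul_zero]) hm
            rintro _ ⟨n, rfl⟩
            exact lie_tmul_self x n
          rw [hxm]
          exact Submodule.zero_mem _ }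
    exact (LieSubmodule.lieSpan_le (N := S)).mpr Submodule.subset_span
  · rw [Submodule.span_le]
    rintro _ ⟨n, rfl⟩
    exact tmul_self_mem_diagonal n

theorem pairMap_mem_diagonal (f : L →ₗ⁅F⁆ L') (h : ∀ x ∈ N, f x ∈ N') {t : PairTensor N}
    (ht : t ∈ diagonal N) : pairMap f h t ∈ diagonal N' := by
  have : diagonal N ≤ LieIdeal.comap (pairMap f h) (diagonal N') := by
    refine LieSubmodule.lieSpan_le.mpr ?_
    rintro _ ⟨n, rfl⟩
    rw [SetLike.mem_coe, LieIdeal.mem_comap, pairMap_tmul]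
    exact tmul_self_mem_diagonal (N := N') ⟨f n, h n n.2⟩
  exact this ht

theorem nonempty_diagonal_equiv (f : L →ₗ⁅F⁆ L') (h : ∀ x ∈ N, f x ∈ N')
    (hsurj : ∀ y ∈ N', ∃ x ∈ N, f x = y) (hinj : ∀ t ∈ diagonal N, pairMap f h t = 0 → t = 0) :
    Nonempty (diagonal N ≃ₗ⁅F⁆ diagonal N') := by
  have hsurj' : ∀ s ∈ diagonal N', ∃ t ∈ diagonal N, pairMap f h t = s := fun s hs => by
    rw [← LieSubmodule.mem_toSubmodule, diagonal_eq_span] at hs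
    refine Submodule.span_induction (p := fun s _ => ∃ t ∈ diagonal N, pairMap f h t = s) ?_
      ⟨0, zero_mem _, map_zero _⟩ ?_ ?_ hs
    · rintro _ ⟨⟨y, hy⟩, rfl⟩
      obtain ⟨x, hx, rfl⟩ := hsurj y hy
      exact ⟨_, tmul_self_mem_diagonal ⟨x, hx⟩, pairMap_tmul _ _ _ _⟩
    · rintro _ _ _ _ ⟨t, ht, rfl⟩ ⟨t', ht', rfl⟩
      exact ⟨t + t', add_mem ht ht', map_add _ _ _⟩
    · rintro c _ _ ⟨t, ht, rfl⟩
      exact ⟨c • t, (diagonal N).smul_mem c ht, map_smul _ _ _⟩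
  refine ⟨LieEquiv.ofBijective (restrictIdeal (pairMap f h) _ _ fun _ => pairMap_mem_diagonal f h)
    ⟨(injective_iff_map_eq_zero _).mpr fun t ht => ?_, fun s => ?_⟩⟩
  · exact Subtype.ext (hinj t t.2 (congrArg Subtype.val ht))
  · obtain ⟨t, ht, hts⟩ := hsurj' s s.2
    exact ⟨⟨t, ht⟩, Subtype.ext hts⟩

/-- The exterior product of pairs is functorial. -/
def pairExtMap (f : L →ₗ⁅F⁆ L') (h : ∀ x ∈ N, f x ∈ N') : PairExterior N →ₗ⁅F⁆ PairExterior N' :=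
  quotLift (diagonal N) ((quotMk (diagonal N')).comp (pairMap f h)) fun t ht => by
    rw [LieHom.mem_ker, LieHom.comp_apply, quotMk_eq_zero]
    exact pairMap_mem_diagonal f h ht

theorem pairExtMap_quotMk (f : L →ₗ⁅F⁆ L') (h : ∀ x ∈ N, f x ∈ N') (t : PairTensor N) :
    pairExtMap f h (quotMk (diagonal N) t) = quotMk (diagonal N') (pairMap f h t) := rfl

theorem pairExtMap_pairExtMap_eq_self (f : L →ₗ⁅F⁆ L') (h : ∀ x ∈ N, f x ∈ N')
    (g : L' →ₗ⁅F⁆ L) (h' : ∀ x ∈ N', g x ∈ N) (hgf : ∀ x, g (f x) = x) (t : PairExterior N) :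
    pairExtMap g h' (pairExtMap f h t) = t := by
  obtain ⟨t, rfl⟩ := quotMk_surjective _ t
  rw [pairExtMap_quotMk, pairExtMap_quotMk, pairMap_pairMap_eq_self _ _ _ _ hgf]

theorem pairExtMap_pairExtMap_eq_zero (f : L →ₗ⁅F⁆ L') (h : ∀ x ∈ N, f x ∈ N')
    (g : L' →ₗ⁅F⁆ L'') (h' : ∀ x ∈ N', g x ∈ N'') (hgf : ∀ x, g (f x) = 0)
    (t : PairExterior N) : pairExtMap g h' (pairExtMap f h t) = 0 := by
  obtain ⟨t, rfl⟩ := quotMk_surjective _ t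
  rw [pairExtMap_quotMk, pairExtMap_quotMk, pairMap_pairMap_eq_zero _ _ _ _ hgf, map_zero]

theorem kappa'_quotMk (t : PairTensor N) : kappa' N (quotMk (diagonal N) t) = kappa N t := rfl

theorem mem_schurMultiplier {t : PairExterior N} : t ∈ schurMultiplier N ↔ kappa' N t = 0 :=
  LieHom.mem_ker

theorem pairExtMap_mem_schurMultiplier (f : L →ₗ⁅F⁆ L') (h : ∀ x ∈ N, f x ∈ N')
    {t : PairExterior N} (ht : t ∈ schurMultiplier N) : pairExtMap f h t ∈ schurMultiplier N' := by
  obtain ⟨t, rfl⟩ := quotMk_surjective _ t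
  rw [mem_schurMultiplier, kappa'_quotMk] at ht
  rw [mem_schurMultiplier, pairExtMap_quotMk, kappa'_quotMk, kappa_pairMap, ht, map_zero]

end Functoriality

section SelfTensor

variable {F : Type u} {L : Type v} {L' : Type w} [Field F] [LieRing L] [LieAlgebra F L]
  [LieRing L'] [LieAlgebra F L']

variable (F L) in
/-- The nonabelian tensor square of `L`. -/
abbrev SelfTensor : Type _ := PairTensor (⊤ : LieIdeal F L)

variable (F L) in
/-- The derived subalgebra of `L`. -/
abbrev derived : LieIdeal F L := ⁅(⊤ : LieIdeal F L), (⊤ : LieIdeal F L)⁆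

variable (F L) in
/-- The identity of `L` as a morphism to its largest ideal. -/
def toTop : L →ₗ⁅F⁆ (⊤ : LieIdeal F L) where
  toFun x := ⟨x, LieSubmodule.mem_top x⟩
  map_add' _ _ := rfl
  map_smul' _ _ := rfl
  map_lie' := rfl

variable (F) in
/-- The generators of the nonabelian tensor square, as a bilinear map on `L`. -/
def selfTmul : L →ₗ[F] L →ₗ[F] SelfTensor F L :=
  (tmulₗ (actOnIdeal ⊤) (idealAct ⊤)).compl₂ (toTop F L : L →ₗ[F] (⊤ : LieIdeal F L))

theorem selfTmul_lie_left (x y z : L) :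
    selfTmul F ⁅x, y⁆ z = selfTmul F x ⁅y, z⁆ - selfTmul F y ⁅x, z⁆ :=
  tmul_lie_left x y _

theorem selfTmul_lie_right (x y z : L) :
    selfTmul F x ⁅y, z⁆ = selfTmul F ⁅z, x⁆ y - selfTmul F ⁅y, x⁆ z := by
  have := tmul_lie_right (φ := actOnIdeal (⊤ : LieIdeal F L)) (ψ := idealAct ⊤) x
    ⟨y, LieSubmodule.mem_top y⟩ ⟨z, LieSubmodule.mem_top z⟩
  rw [idealAct_apply, idealAct_apply] at this
  exact this

theorem lie_selfTmul (x y z w : L) :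
    ⁅selfTmul F x y, selfTmul F z w⁆ = selfTmul F ⁅x, y⁆ ⁅z, w⁆ := by
  have := lie_tmul_tmul (φ := actOnIdeal (⊤ : LieIdeal F L)) (ψ := idealAct ⊤) x z
    ⟨y, LieSubmodule.mem_top y⟩ ⟨w, LieSubmodule.mem_top w⟩
  rw [idealAct_apply, ← tmul_neg_left, lie_skew] at this
  exact this

theorem kappa_selfTmul (x y : L) : kappa ⊤ (selfTmul F x y) = ⁅x, y⁆ := kappa_tmul _ _ _

theorem selfTensor_linearMap_ext {V : Type*} [AddCommGroup V] [Module F V]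
    {f g : SelfTensor F L →ₗ[F] V} (h : ∀ x y, f (selfTmul F x y) = g (selfTmul F x y)) : f = g :=
  tensor_linearMap_ext fun l n => h l n

theorem selfTmul_lie_skew (x a b : L) : selfTmul F x ⁅a, b⁆ = -selfTmul F ⁅a, b⁆ x := by
  have h₁ := selfTmul_lie_right (F := F) x a b
  have h₂ := selfTmul_lie_left (F := F) a b x
  have h₃ := selfTmul_lie_right (F := F) a b x
  have h₄ := selfTmul_lie_right (F := F) b a x
  rw [← lie_skew b a, map_neg, LinearMap.neg_apply] at h₃
  rw [← lie_skew x b, map_neg, LinearMap.neg_apply] at h₄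
  rw [← lie_skew a x, map_neg, LinearMap.neg_apply] at h₁
  linear_combination (norm := module) h₁ - h₂ - h₃ + h₄

theorem mem_derived_iff (x : L) :
    x ∈ derived F L ↔ x ∈ Submodule.span F {z : L | ∃ x y : L, ⁅x, y⁆ = z} := by
  rw [← LieSubmodule.mem_toSubmodule, LieSubmodule.lieIdeal_oper_eq_linear_span']
  simp

theorem lie_mem_derived (x y : L) : ⁅x, y⁆ ∈ derived F L :=
  LieSubmodule.lie_mem_lie (LieSubmodule.mem_top x) (LieSubmodule.mem_top y)

theorem map_mem_derived (f : L →ₗ⁅F⁆ L') {x : L} (hx : x ∈ derived F L) : f x ∈ derived F L' := by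
  rw [mem_derived_iff] at hx
  refine Submodule.span_induction (p := fun x _ => f x ∈ derived F L') ?_ (by simp)
    (fun x y _ _ hx hy => by rw [map_add]; exact add_mem hx hy)
    (fun c x _ hx => by rw [map_smul]; exact (derived F L').smul_mem c hx) hx
  rintro _ ⟨x, y, rfl⟩
  rw [LieHom.map_lie]
  exact lie_mem_derived _ _

theorem selfTmul_skew_of_mem_derived (x : L) {c : L} (hc : c ∈ derived F L) :
    selfTmul F x c = -selfTmul F c x := by
  rw [mem_derived_iff] at hc
  refine Submodule.span_induction (p := fun c _ => selfTmul F x c = -selfTmul F c x) ?_ (by simp)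
    (fun c d _ _ hc hd => by rw [map_add, map_add, hc, hd, LinearMap.add_apply]; abel)
    (fun k c _ hc => by rw [map_smul, map_smul, hc, LinearMap.smul_apply, smul_neg]) hc
  rintro _ ⟨a, b, rfl⟩
  exact selfTmul_lie_skew x a b

theorem selfTmul_self_of_mem_derived {c : L} (hc : c ∈ derived F L) : selfTmul F c c = 0 := by
  rw [mem_derived_iff] at hc
  refine Submodule.span_induction (p := fun c _ => selfTmul F c c = 0) ?_ (by simp)
    (fun c d _ hd hc' hd' => ?_)
    (fun k c _ hc => by rw [map_smul, map_smul, LinearMap.smul_apply, hc, smul_zero, smul_zero]) hc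
  · rintro _ ⟨a, b, rfl⟩
    rw [← lie_selfTmul, lie_self]
  · rw [map_add, map_add, LinearMap.add_apply, LinearMap.add_apply, hc', hd',
      selfTmul_skew_of_mem_derived c ((mem_derived_iff d).mpr hd)]
    abel

theorem selfTmul_self_congr {x y : L} (h : x - y ∈ derived F L) :
    selfTmul F x x = selfTmul F y y := by
  obtain ⟨c, hc, rfl⟩ : ∃ c ∈ derived F L, x = y + c := ⟨x - y, h, by abel⟩
  rw [map_add, map_add, LinearMap.add_apply, LinearMap.add_apply,
    selfTmul_self_of_mem_derived hc, selfTmul_skew_of_mem_derived y hc]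
  abel

variable (F L) in
/-- The symmetrised generators `x ⊗ y + y ⊗ x`. -/
def symTmul : L →ₗ[F] L →ₗ[F] SelfTensor F L := selfTmul F + (selfTmul F).flip

theorem symTmul_apply (x y : L) : symTmul F L x y = selfTmul F x y + selfTmul F y x := rfl

theorem symTmul_comm (x y : L) : symTmul F L x y = symTmul F L y x := by
  rw [symTmul_apply, symTmul_apply, add_comm]

theorem symTmul_of_mem_derived_right (x : L) {c : L} (hc : c ∈ derived F L) :
    symTmul F L x c = 0 := by
  rw [symTmul_apply, selfTmul_skew_of_mem_derived x hc, neg_add_cancel]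

theorem symTmul_congr {x x' y y' : L} (hx : x - x' ∈ derived F L) (hy : y - y' ∈ derived F L) :
    symTmul F L x y = symTmul F L x' y' := by
  have h₁ := symTmul_of_mem_derived_right y hx
  have h₂ := symTmul_of_mem_derived_right x' hy
  rw [symTmul_comm, map_sub, LinearMap.sub_apply, sub_eq_zero] at h₁
  rw [map_sub, sub_eq_zero] at h₂
  rw [h₁, h₂]

theorem lie_symTmul (x y z w : L) : ⁅symTmul F L x y, symTmul F L z w⁆ = 0 := by
  rw [symTmul_apply, add_lie, symTmul_apply]
  simp only [lie_add, lie_selfTmul]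
  rw [← lie_skew x y, map_neg]
  simp only [LinearMap.neg_apply]
  abel

theorem kappa_symTmul (x y : L) : kappa ⊤ (symTmul F L x y) = 0 := by
  rw [symTmul_apply, map_add, kappa_selfTmul, kappa_selfTmul, ← lie_skew, neg_add_cancel]

/-- The map of tensor squares induced by a morphism. -/
def selfMap (f : L →ₗ⁅F⁆ L') : SelfTensor F L →ₗ⁅F⁆ SelfTensor F L' :=
  pairMap f fun _ _ => LieSubmodule.mem_top _

@[simp]
theorem selfMap_selfTmul (f : L →ₗ⁅F⁆ L') (x y : L) :
    selfMap f (selfTmul F x y) = selfTmul F (f x) (f y) :=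
  pairMap_tmul _ _ _ _

theorem selfTmul_self_mem_diagonal (x : L) : selfTmul F x x ∈ diagonal (⊤ : LieIdeal F L) :=
  tmul_self_mem_diagonal (N := ⊤) ⟨x, LieSubmodule.mem_top x⟩

theorem diagonal_top_eq_span : (diagonal (⊤ : LieIdeal F L)).toSubmodule =
    Submodule.span F (Set.range fun x : L => selfTmul F x x) := by
  rw [diagonal_eq_span]
  congr 1
  ext t
  exact ⟨fun ⟨n, h⟩ => ⟨n, h.symm⟩, fun ⟨x, h⟩ => ⟨⟨x, LieSubmodule.mem_top x⟩, h.symm⟩⟩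

end SelfTensor

section Trivial

/-- A vector space regarded as an abelian Lie algebra that is a trivial module over every Lie
algebra. -/
def TrivialLie (V : Type*) : Type _ := V

variable {F : Type u} {L : Type v} {V : Type w} [Field F] [LieRing L] [LieAlgebra F L]
  [AddCommGroup V] [Module F V]

instance : AddCommGroup (TrivialLie V) := inferInstanceAs (AddCommGroup V)

instance : Module F (TrivialLie V) := inferInstanceAs (Module F V)

instance : LieRing (TrivialLie V) where
  bracket _ _ := 0
  add_lie _ _ _ := (add_zero 0).symm
  lie_add _ _ _ := (add_zero 0).symm
  lie_self _ := rfl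
  leibniz_lie _ _ _ := (add_zero 0).symm

instance : LieAlgebra F (TrivialLie V) where
  lie_smul c _ _ := (smul_zero (A := TrivialLie V) c).symm

instance : LieRingModule L (TrivialLie V) where
  bracket _ _ := 0
  add_lie _ _ _ := (add_zero 0).symm
  lie_add _ _ _ := (add_zero 0).symm
  leibniz_lie _ _ _ := (add_zero 0).symm

instance : LieModule F L (TrivialLie V) where
  smul_lie c _ _ := (smul_zero (A := TrivialLie V) c).symm
  lie_smul c _ _ := (smul_zero (A := TrivialLie V) c).symm

instance : LieModule.IsTrivial L (TrivialLie V) where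
  trivial _ _ := rfl

variable (F V) in
/-- The identity map from a vector space to the abelian Lie algebra on it. -/
def TrivialLie.equiv : V ≃ₗ[F] TrivialLie V := LinearEquiv.refl F V

theorem exists_linearMap_selfTmul (f : L →ₗ[F] L →ₗ[F] V) (h₁ : ∀ x y z : L, f ⁅x, y⁆ z = 0)
    (h₂ : ∀ x y z : L, f x ⁅y, z⁆ = 0) :
    ∃ e : SelfTensor F L →ₗ[F] V, ∀ x y, e (selfTmul F x y) = f x y := by
  let f' : L →ₗ[F] (⊤ : LieIdeal F L) →ₗ[F] TrivialLie V :=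
    (f.compl₂ ((⊤ : LieIdeal F L).toSubmodule.subtype)).compr₂
      (TrivialLie.equiv F V : V →ₗ[F] TrivialLie V)
  have hf' : IsLiePairing (actOnIdeal ⊤) (idealAct ⊤) f' :=
    { lie_left := fun l l' n => by
        change f ⁅l, l'⁆ (n : L) = f l ⁅l', (n : L)⁆ - f l' ⁅l, (n : L)⁆
        rw [h₁, h₂, h₂, sub_zero]
      lie_right := fun l n n' => by
        rw [idealAct_apply, idealAct_apply]
        change f l ⁅(n : L), (n' : L)⁆ = f ⁅(n' : L), l⁆ n - f ⁅(n : L), l⁆ n'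
        rw [h₁, h₁, h₂, sub_zero]
      lie_lie := fun l l' n n' => by
        change (0 : V) = -f (idealAct ⊤ n l) ⁅l', (n' : L)⁆
        rw [h₂, neg_zero] }
  exact ⟨((TrivialLie.equiv F V).symm : TrivialLie V →ₗ[F] V) ∘ₗ
    (tensorLift f' hf' : SelfTensor F L →ₗ[F] TrivialLie V), fun x y =>
    tensorLift_tmul f' hf' x ⟨y, LieSubmodule.mem_top y⟩⟩

end Trivial

section Abelianization

variable {F : Type u} {L : Type v} [Field F] [LieRing L] [LieAlgebra F L]

variable (F L) in
/-- The projection of `L` onto its abelianization. -/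
def abMk : L →ₗ⁅F⁆ Coinv (⊤ : LieIdeal F L) :=
  (quotMk _).comp (toTop F L)

theorem abMk_surjective : Function.Surjective (abMk F L) := fun t => by
  obtain ⟨x, rfl⟩ := quotMk_surjective _ t
  exact ⟨x, rfl⟩

theorem abMk_eq_zero {x : L} : abMk F L x = 0 ↔ x ∈ derived F L :=
  quotMk_eq_zero.trans LieIdeal.mem_comap

theorem abMk_lie (x y : L) : abMk F L ⁅x, y⁆ = 0 := abMk_eq_zero.mpr (lie_mem_derived x y)

theorem lie_coinv_eq_zero (s t : Coinv (⊤ : LieIdeal F L)) : ⁅s, t⁆ = 0 := by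
  obtain ⟨x, rfl⟩ := abMk_surjective s
  obtain ⟨y, rfl⟩ := abMk_surjective t
  rw [← LieHom.map_lie, abMk_lie]

theorem exists_abMk_section : ∃ s : Coinv (⊤ : LieIdeal F L) →ₗ[F] L,
    ∀ x, s (abMk F L x) - x ∈ derived F L := by
  obtain ⟨s, hs⟩ := (abMk F L : L →ₗ[F] Coinv (⊤ : LieIdeal F L)).exists_rightInverse_of_surjective
    (LinearMap.range_eq_top.mpr abMk_surjective)
  refine ⟨s, fun x => abMk_eq_zero.mp ?_⟩
  rw [map_sub, sub_eq_zero]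
  exact LinearMap.congr_fun hs (abMk F L x)

end Abelianization

section Cocycle

variable {F : Type u} {L₁ : Type v} {L₂ : Type w} [Field F] [LieRing L₁] [LieAlgebra F L₁]
  [LieRing L₂] [LieAlgebra F L₂] {V : Type z} [AddCommGroup V] [Module F V]

open LieAlgebra LieModule.Cohomology

/-- The lift of a morphism `f` to the extension defined by a two-cocycle vanishing on the image
of `f`. -/
def cocycleSection {L : Type*} [LieRing L] [LieAlgebra F L] [LieRingModule L V] [LieModule F L V]
    (c : twoCocycle F L V) (f : L₁ →ₗ⁅F⁆ L) (h : ∀ x y, c.1 (f x) (f y) = 0) :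
    L₁ →ₗ⁅F⁆ ofTwoCocycle c where
  toFun x := ofProd c (f x, 0)
  map_add' x y := by rw [← of_add]; simp
  map_smul' a x := by rw [RingHom.id_apply, ← of_smul]; simp
  map_lie' {x y} := by simp [bracket_ofTwoCocycle, h]

/-- The two lifts of the factors to the extension defined by `c` combine to a section of it, whose
`V`-component is the primitive. -/
theorem FreeProd.exists_primitive [LieRingModule (FreeProd F L₁ L₂) V]
    [LieModule F (FreeProd F L₁ L₂) V] [LieModule.IsTrivial (FreeProd F L₁ L₂) V]
    (c : twoCocycle F (FreeProd F L₁ L₂) V)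
    (h₁ : ∀ x y, c.1 (inl F L₁ L₂ x) (inl F L₁ L₂ y) = 0)
    (h₂ : ∀ x y, c.1 (inr F L₁ L₂ x) (inr F L₁ L₂ y) = 0) :
    ∃ θ : FreeProd F L₁ L₂ →ₗ[F] V, ∀ x y, c.1 x y = θ ⁅x, y⁆ := by
  let s := lift (cocycleSection c (inl F L₁ L₂) h₁) (cocycleSection c (inr F L₁ L₂) h₂)
  have hs (x : FreeProd F L₁ L₂) : (s x).carrier.1 = x := by
    let p : ofTwoCocycle c →ₗ⁅F⁆ FreeProd F L₁ L₂ :=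
      { toFun := fun e => e.carrier.1
        map_add' := fun _ _ => rfl
        map_smul' := fun _ _ => rfl
        map_lie' := rfl }
    have hid : p.comp s = LieHom.id := hom_ext
      (fun x => by rw [LieHom.comp_apply, lift_inl]; rfl)
      (fun x => by rw [LieHom.comp_apply, lift_inr]; rfl)
    exact LieHom.congr_fun hid x
  refine ⟨{ toFun := fun x => (s x).carrier.2
            map_add' := fun x y => by rw [map_add]; rfl
            map_smul' := fun a x => by rw [map_smul]; rfl }, fun x y => ?_⟩
  have hlie := congrArg (fun e => e.carrier.2) (s.map_lie x y)
  rw [bracket_ofTwoCocycle] at hlie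
  simpa [ofProd, hs, trivial_lie_zero] using hlie.symm

/-- The bilinear map `(x, y) ↦ P (x ⊗ y)` is a cocycle with trivial coefficients, hence
`P (x ⊗ y)` depends only on `⁅x, y⁆`. -/
theorem map_eq_zero_of_mem_J₂ (P : SelfTensor F (FreeProd F L₁ L₂) →ₗ[F] V)
    (hself : ∀ x, P (selfTmul F x x) = 0)
    (h₁ : ∀ x y, P (selfTmul F (FreeProd.inl F L₁ L₂ x) (FreeProd.inl F L₁ L₂ y)) = 0)
    (h₂ : ∀ x y, P (selfTmul F (FreeProd.inr F L₁ L₂ x) (FreeProd.inr F L₁ L₂ y)) = 0)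
    {t : SelfTensor F (FreeProd F L₁ L₂)} (ht : t ∈ J₂ ⊤) : P t = 0 := by
  let P' : SelfTensor F (FreeProd F L₁ L₂) →ₗ[F] TrivialLie V := P
  let a : twoCochain F (FreeProd F L₁ L₂) (TrivialLie V) := ⟨(selfTmul F).compr₂ P', hself⟩
  have ha : a ∈ twoCocycle F (FreeProd F L₁ L₂) (TrivialLie V) := by
    rw [mem_twoCocycle_iff_of_trivial]
    intro x y z
    change P' (selfTmul F x ⁅y, z⁆) = P' (selfTmul F ⁅x, y⁆ z) + P' (selfTmul F y ⁅x, z⁆)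
    rw [selfTmul_lie_left, map_sub, sub_add_cancel]
  obtain ⟨θ, hθ⟩ := FreeProd.exists_primitive ⟨a, ha⟩ h₁ h₂
  have hP : P' = θ ∘ₗ (kappa (⊤ : LieIdeal F (FreeProd F L₁ L₂))).toLinearMap :=
    selfTensor_linearMap_ext fun x y => by
      rw [LinearMap.comp_apply, LieHom.coe_toLinearMap, kappa_selfTmul]
      exact hθ x y
  change P' t = 0
  rw [hP, LinearMap.comp_apply, LieHom.coe_toLinearMap, mem_J₂.mp ht, map_zero]

end Cocycle

section Splitting

variable {F : Type u} {L₁ : Type v} {L₂ : Type w} [Field F] [LieRing L₁] [LieAlgebra F L₁]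
  [LieRing L₂] [LieAlgebra F L₂]

variable (F L₁ L₂) in
/-- The projection of the free product onto the first factor. -/
def FreeProd.fst : FreeProd F L₁ L₂ →ₗ⁅F⁆ L₁ := FreeProd.lift LieHom.id 0

variable (F L₁ L₂) in
/-- The projection of the free product onto the second factor. -/
def FreeProd.snd : FreeProd F L₁ L₂ →ₗ⁅F⁆ L₂ := FreeProd.lift 0 LieHom.id

@[simp]
theorem FreeProd.fst_inl (x : L₁) : FreeProd.fst F L₁ L₂ (FreeProd.inl F L₁ L₂ x) = x :=
  FreeProd.lift_inl _ _ _

@[simp]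
theorem FreeProd.fst_inr (x : L₂) : FreeProd.fst F L₁ L₂ (FreeProd.inr F L₁ L₂ x) = 0 :=
  FreeProd.lift_inr _ _ _

@[simp]
theorem FreeProd.snd_inl (x : L₁) : FreeProd.snd F L₁ L₂ (FreeProd.inl F L₁ L₂ x) = 0 :=
  FreeProd.lift_inl _ _ _

@[simp]
theorem FreeProd.snd_inr (x : L₂) : FreeProd.snd F L₁ L₂ (FreeProd.inr F L₁ L₂ x) = x :=
  FreeProd.lift_inr _ _ _

variable {N₁ : LieIdeal F L₁} {N₂ : LieIdeal F L₂} {N : LieIdeal F (FreeProd F L₁ L₂)}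
  (hN : N.toLieSubalgebra = freeProdSubalgebra N₁ N₂)

include hN

theorem fst_mem {x : FreeProd F L₁ L₂} (hx : x ∈ N) : FreeProd.fst F L₁ L₂ x ∈ N₁ := by
  have hle : freeProdSubalgebra N₁ N₂ ≤ N₁.toLieSubalgebra.comap (FreeProd.fst F L₁ L₂) :=
    freeProdSubalgebra_le (fun x hx => by simpa using hx) fun y _ => by simp
  exact hle (hN.le hx)

theorem snd_mem {x : FreeProd F L₁ L₂} (hx : x ∈ N) : FreeProd.snd F L₁ L₂ x ∈ N₂ := by
  have hle : freeProdSubalgebra N₁ N₂ ≤ N₂.toLieSubalgebra.comap (FreeProd.snd F L₁ L₂) :=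
    freeProdSubalgebra_le (fun x _ => by simp) fun y hy => by simpa using hy
  exact hle (hN.le hx)

/-- The map `(L₁ * L₂) ⊗ (N₁ * N₂) → L₁ ⊗ N₁` induced by the projection. -/
abbrev pairFst : PairTensor N →ₗ⁅F⁆ PairTensor N₁ :=
  pairMap (FreeProd.fst F L₁ L₂) fun _ => fst_mem hN

/-- The map `(L₁ * L₂) ⊗ (N₁ * N₂) → L₂ ⊗ N₂` induced by the projection. -/
abbrev pairSnd : PairTensor N →ₗ⁅F⁆ PairTensor N₂ :=
  pairMap (FreeProd.snd F L₁ L₂) fun _ => snd_mem hN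

/-- The map `L₁ ⊗ N₁ → (L₁ * L₂) ⊗ (N₁ * N₂)` induced by the inclusion. -/
abbrev pairInl : PairTensor N₁ →ₗ⁅F⁆ PairTensor N :=
  pairMap (FreeProd.inl F L₁ L₂) fun _ => inl_mem hN

/-- The map `L₂ ⊗ N₂ → (L₁ * L₂) ⊗ (N₁ * N₂)` induced by the inclusion. -/
abbrev pairInr : PairTensor N₂ →ₗ⁅F⁆ PairTensor N :=
  pairMap (FreeProd.inr F L₁ L₂) fun _ => inr_mem hN

theorem pairFst_pairInl (t : PairTensor N₁) : pairFst hN (pairInl hN t) = t :=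
  pairMap_pairMap_eq_self _ _ _ _ FreeProd.fst_inl t

theorem pairFst_pairInr (t : PairTensor N₂) : pairFst hN (pairInr hN t) = 0 :=
  pairMap_pairMap_eq_zero _ _ _ _ FreeProd.fst_inr t

theorem pairSnd_pairInl (t : PairTensor N₁) : pairSnd hN (pairInl hN t) = 0 :=
  pairMap_pairMap_eq_zero _ _ _ _ FreeProd.snd_inl t

theorem pairSnd_pairInr (t : PairTensor N₂) : pairSnd hN (pairInr hN t) = t :=
  pairMap_pairMap_eq_self _ _ _ _ FreeProd.snd_inr t

theorem nonempty_J₂_equiv_prod {T : Type*} [LieRing T] [LieAlgebra F T]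
    (Φ : PairTensor N →ₗ⁅F⁆ T) (Ψ : T →ₗ⁅F⁆ PairTensor N) (hΨ : ∀ s, Ψ s ∈ J₂ N)
    (hΦΨ : ∀ s, Φ (Ψ s) = s) (hΦ₁ : ∀ t, Φ (pairInl hN t) = 0) (hΦ₂ : ∀ t, Φ (pairInr hN t) = 0)
    (hΨ₁ : ∀ s, pairFst hN (Ψ s) = 0) (hΨ₂ : ∀ s, pairSnd hN (Ψ s) = 0)
    (hsplit : ∀ t ∈ J₂ N, t = pairInl hN (pairFst hN t) + pairInr hN (pairSnd hN t) + Ψ (Φ t)) :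
    Nonempty (J₂ N ≃ₗ⁅F⁆ (J₂ N₁ × J₂ N₂ × T)) := by
  let p := restrictIdeal (pairFst hN) (J₂ N) (J₂ N₁) fun _ => pairMap_mem_J₂ _ _
  let q := restrictIdeal (pairSnd hN) (J₂ N) (J₂ N₂) fun _ => pairMap_mem_J₂ _ _
  refine ⟨LieEquiv.ofBijective (p.prod (q.prod (Φ.comp (J₂ N).incl))) ⟨?_, ?_⟩⟩
  · refine (injective_iff_map_eq_zero _).mpr fun t ht => Subtype.ext ?_
    have h₁ : pairFst hN t = 0 := congrArg (fun u => (u.1 : PairTensor N₁)) ht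
    have h₂ : pairSnd hN t = 0 := congrArg (fun u => (u.2.1 : PairTensor N₂)) ht
    have h₃ : Φ t = 0 := congrArg (fun u => u.2.2) ht
    rw [hsplit t t.2, h₁, h₂, h₃]
    simp
  · rintro ⟨a, b, s⟩
    refine ⟨⟨pairInl hN a + pairInr hN b + Ψ s, add_mem (add_mem (pairMap_mem_J₂ _ _ a.2)
      (pairMap_mem_J₂ _ _ b.2)) (hΨ s)⟩, Prod.ext (Subtype.ext ?_) (Prod.ext (Subtype.ext ?_) ?_)⟩
    · change pairFst hN (_ + _ + _) = a
      rw [map_add, map_add, pairFst_pairInl, pairFst_pairInr, hΨ₁, add_zero, add_zero]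
    · change pairSnd hN (_ + _ + _) = b
      rw [map_add, map_add, pairSnd_pairInl, pairSnd_pairInr, hΨ₂, add_zero, zero_add]
    · change Φ (_ + _ + _) = s
      rw [map_add, map_add, hΦ₁, hΦ₂, hΦΨ, zero_add, zero_add]

theorem nonempty_schurMultiplier_equiv_prod
    (hsplit : ∀ t ∈ J₂ N, quotMk (diagonal N) t =
      quotMk _ (pairInl hN (pairFst hN t)) + quotMk _ (pairInr hN (pairSnd hN t))) :
    Nonempty (schurMultiplier N ≃ₗ⁅F⁆ (schurMultiplier N₁ × schurMultiplier N₂)) := by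
  let p := pairExtMap (FreeProd.fst F L₁ L₂) fun _ => fst_mem hN
  let q := pairExtMap (FreeProd.snd F L₁ L₂) fun _ => snd_mem hN
  let i := pairExtMap (FreeProd.inl F L₁ L₂) fun _ => inl_mem hN
  let j := pairExtMap (FreeProd.inr F L₁ L₂) fun _ => inr_mem hN
  let p' := restrictIdeal p (schurMultiplier N) (schurMultiplier N₁) fun _ =>
    pairExtMap_mem_schurMultiplier _ _
  let q' := restrictIdeal q (schurMultiplier N) (schurMultiplier N₂) fun _ =>
    pairExtMap_mem_schurMultiplier _ _
  have hsplit' : ∀ t ∈ schurMultiplier N, t = i (p t) + j (q t) := fun t ht => by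
    obtain ⟨t, rfl⟩ := quotMk_surjective _ t
    exact hsplit t ht
  refine ⟨LieEquiv.ofBijective (p'.prod q') ⟨?_, ?_⟩⟩
  · refine (injective_iff_map_eq_zero _).mpr fun t ht => Subtype.ext ?_
    have h₁ : p t = 0 := congrArg (fun u => (u.1 : PairExterior N₁)) ht
    have h₂ : q t = 0 := congrArg (fun u => (u.2 : PairExterior N₂)) ht
    rw [hsplit' t t.2, h₁, h₂]
    simp
  · rintro ⟨a, b⟩
    refine ⟨⟨i a + j b, add_mem (pairExtMap_mem_schurMultiplier _ _ a.2)
      (pairExtMap_mem_schurMultiplier _ _ b.2)⟩, Prod.ext (Subtype.ext ?_) (Subtype.ext ?_)⟩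
    · change p (i (a : PairExterior N₁) + j (b : PairExterior N₂)) = (a : PairExterior N₁)
      rw [map_add, pairExtMap_pairExtMap_eq_self _ _ _ _ FreeProd.fst_inl,
        pairExtMap_pairExtMap_eq_zero _ _ _ _ FreeProd.fst_inr, add_zero]
    · change q (i (a : PairExterior N₁) + j (b : PairExterior N₂)) = (b : PairExterior N₂)
      rw [map_add, pairExtMap_pairExtMap_eq_zero _ _ _ _ FreeProd.snd_inl,
        pairExtMap_pairExtMap_eq_self _ _ _ _ FreeProd.snd_inr, zero_add]

theorem prod_fst_snd_mem {x : FreeProd F L₁ L₂} (hx : x ∈ N) :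
    (FreeProd.fst F L₁ L₂).prod (FreeProd.snd F L₁ L₂) x ∈ prodIdeal N₁ N₂ :=
  (mem_prodIdeal _ _ _).mpr ⟨fst_mem hN hx, snd_mem hN hx⟩

theorem nonempty_diagonal_equiv_diagonal_prodIdeal
    (hinj : ∀ t ∈ diagonal N, pairMap ((FreeProd.fst F L₁ L₂).prod (FreeProd.snd F L₁ L₂))
      (fun _ => prod_fst_snd_mem hN) t = 0 → t = 0) :
    Nonempty (diagonal N ≃ₗ⁅F⁆ diagonal (prodIdeal N₁ N₂)) := by
  refine nonempty_diagonal_equiv _ _ (fun ⟨x, y⟩ h => ?_) hinj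
  obtain ⟨hx, hy⟩ := (mem_prodIdeal _ _ _).mp h
  exact ⟨FreeProd.inl F L₁ L₂ x + FreeProd.inr F L₁ L₂ y,
    add_mem (inl_mem hN hx) (inr_mem hN hy), Prod.ext (by simp) (by simp)⟩

theorem nonempty_diagonal_equiv_of_split
    (hsplit : ∀ t, t = pairInl hN (pairFst hN t) + pairInr hN (pairSnd hN t)) :
    Nonempty (diagonal N ≃ₗ⁅F⁆ diagonal (prodIdeal N₁ N₂)) := by
  refine nonempty_diagonal_equiv_diagonal_prodIdeal hN fun t _ ht => ?_
  have h₁ : pairFst hN t = 0 := by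
    rw [← pairMap_pairMap _ (fun _ => prod_fst_snd_mem hN) (LieHom.fst F L₁ L₂)
      (fun _ h => ((mem_prodIdeal _ _ _).mp h).1) _ _ fun _ => rfl, ht, map_zero]
  have h₂ : pairSnd hN t = 0 := by
    rw [← pairMap_pairMap _ (fun _ => prod_fst_snd_mem hN) (LieHom.snd F L₁ L₂)
      (fun _ h => ((mem_prodIdeal _ _ _).mp h).2) _ _ fun _ => rfl, ht, map_zero]
  rw [hsplit t, h₁, h₂, map_zero, map_zero, add_zero]

theorem nonempty_schurMultiplier_equiv_of_split
    (hsplit : ∀ t, t = pairInl hN (pairFst hN t) + pairInr hN (pairSnd hN t)) :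
    Nonempty (schurMultiplier N ≃ₗ⁅F⁆ (schurMultiplier N₁ × schurMultiplier N₂)) :=
  nonempty_schurMultiplier_equiv_prod hN fun t _ => by rw [← map_add, ← hsplit]

theorem nonempty_J₂_equiv_of_split {T : Type*} [LieRing T] [LieAlgebra F T] [Subsingleton T]
    (hsplit : ∀ t, t = pairInl hN (pairFst hN t) + pairInr hN (pairSnd hN t)) :
    Nonempty (J₂ N ≃ₗ⁅F⁆ (J₂ N₁ × J₂ N₂ × T)) :=
  nonempty_J₂_equiv_prod hN 0 0 (fun _ => zero_mem _) (fun _ => Subsingleton.elim _ _)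
    (fun _ => rfl) (fun _ => rfl) (fun _ => map_zero _) (fun _ => map_zero _) fun t _ => by
      rw [LieHom.zero_apply, add_zero]
      exact hsplit t

end Splitting

section CoinvTensor

variable {F : Type u} {L : Type v} {L₁ : Type w} {L₂ : Type z} [Field F] [LieRing L]
  [LieAlgebra F L] [LieRing L₁] [LieAlgebra F L₁] [LieRing L₂] [LieAlgebra F L₂]

/-- The tensor product of `N₁ / [N₁, L₁]` and `N₂ / [N₂, L₂]`, which act trivially on each
other. -/
abbrev CoinvTensor (N₁ : LieIdeal F L₁) (N₂ : LieIdeal F L₂) : Type _ :=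
  NonabTensor (0 : Coinv N₁ →ₗ⁅F⁆ LieDerivation F (Coinv N₂) (Coinv N₂))
    (0 : Coinv N₂ →ₗ⁅F⁆ LieDerivation F (Coinv N₁) (Coinv N₁))

theorem coinvTensor_linearMap_ext {V : Type*} [AddCommGroup V] [Module F V]
    {f g : CoinvTensor (⊤ : LieIdeal F L₁) (⊤ : LieIdeal F L₂) →ₗ[F] V}
    (h : ∀ x y, f (tmul 0 0 (abMk F L₁ x) (abMk F L₂ y)) =
      g (tmul 0 0 (abMk F L₁ x) (abMk F L₂ y))) : f = g :=
  tensor_linearMap_ext fun a b => by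
    obtain ⟨x, rfl⟩ := abMk_surjective a
    obtain ⟨y, rfl⟩ := abMk_surjective b
    exact h x y

theorem exists_lieHom_coinvTensor_symTmul (f : L₁ →ₗ⁅F⁆ L) (g : L₂ →ₗ⁅F⁆ L) :
    ∃ Ψ : CoinvTensor (⊤ : LieIdeal F L₁) (⊤ : LieIdeal F L₂) →ₗ⁅F⁆ SelfTensor F L,
      ∀ x y, Ψ (tmul 0 0 (abMk F L₁ x) (abMk F L₂ y)) = symTmul F L (f x) (g y) := by
  obtain ⟨s₁, hs₁⟩ := exists_abMk_section (F := F) (L := L₁)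
  obtain ⟨s₂, hs₂⟩ := exists_abMk_section (F := F) (L := L₂)
  let B := (symTmul F L).compl₁₂ ((f : L₁ →ₗ[F] L) ∘ₗ s₁) ((g : L₂ →ₗ[F] L) ∘ₗ s₂)
  have hB : IsLiePairing 0 0 B :=
    { lie_left := fun l l' n => by simp [lie_coinv_eq_zero]
      lie_right := fun l n n' => by rw [lie_coinv_eq_zero]; simp
      lie_lie := fun l l' n n' => by
        simp only [B, LinearMap.compl₁₂_apply, lie_symTmul]
        simp }
  refine ⟨tensorLift B hB, fun x y => ?_⟩
  rw [tensorLift_tmul]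
  refine symTmul_congr ?_ ?_
  · rw [LinearMap.comp_apply, LieHom.coe_toLinearMap, ← map_sub]
    exact map_mem_derived _ (hs₁ x)
  · rw [LinearMap.comp_apply, LieHom.coe_toLinearMap, ← map_sub]
    exact map_mem_derived _ (hs₂ y)

theorem exists_lieHom_selfTensor_coinvTensor (p : L →ₗ⁅F⁆ L₁) (q : L →ₗ⁅F⁆ L₂) :
    ∃ Φ : SelfTensor F L →ₗ⁅F⁆ CoinvTensor (⊤ : LieIdeal F L₁) (⊤ : LieIdeal F L₂),
      ∀ x y, Φ (selfTmul F x y) = tmul 0 0 (abMk F L₁ (p x)) (abMk F L₂ (q y)) := by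
  let B : L →ₗ[F] (⊤ : LieIdeal F L) →ₗ[F]
      CoinvTensor (⊤ : LieIdeal F L₁) (⊤ : LieIdeal F L₂) :=
    (tmulₗ 0 0).compl₁₂ ((abMk F L₁).comp p : L →ₗ[F] _)
      (((abMk F L₂).comp q).comp (LieIdeal.incl ⊤) : (⊤ : LieIdeal F L) →ₗ[F] _)
  have hB_apply (x : L) (y : (⊤ : LieIdeal F L)) :
    B x y = tmul 0 0 (abMk F L₁ (p x)) (abMk F L₂ (q (y : L))) := rfl
  have hB : IsLiePairing (actOnIdeal ⊤) (idealAct ⊤) B :=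
    { lie_left := fun l l' n => by
        simp only [hB_apply, actOnIdeal_apply_coe, LieHom.map_lie, lie_coinv_eq_zero,
          tmul_zero_left, tmul_zero_right, sub_zero]
      lie_right := fun l n n' => by
        simp only [hB_apply, idealAct_apply, LieIdeal.coe_bracket_of_module,
          LieSubmodule.coe_bracket, LieHom.map_lie, lie_coinv_eq_zero, tmul_zero_left,
          tmul_zero_right, sub_zero]
      lie_lie := fun l l' n n' => by
        simp only [hB_apply, lie_coinv_eq_zero, actOnIdeal_apply_coe, LieHom.map_lie,
          tmul_zero_right, neg_zero]
        simp [lie_tmul_tmul] }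
  exact ⟨tensorLift B hB, fun x y => tensorLift_tmul B hB x (toTop F L y)⟩

end CoinvTensor

section FullCase

variable {F : Type u} {L₁ : Type v} {L₂ : Type w} [Field F] [LieRing L₁] [LieAlgebra F L₁]
  [LieRing L₂] [LieAlgebra F L₂]

theorem FreeProd.sub_inl_fst_add_inr_snd_mem_derived (x : FreeProd F L₁ L₂) :
    x - (inl F L₁ L₂ (fst F L₁ L₂ x) + inr F L₁ L₂ (snd F L₁ L₂ x)) ∈
      derived F (FreeProd F L₁ L₂) := by
  let r : FreeProd F L₁ L₂ →ₗ[F] FreeProd F L₁ L₂ := LinearMap.id -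
    ((inl F L₁ L₂).comp (fst F L₁ L₂) : FreeProd F L₁ L₂ →ₗ[F] FreeProd F L₁ L₂) -
    ((inr F L₁ L₂).comp (snd F L₁ L₂) : FreeProd F L₁ L₂ →ₗ[F] FreeProd F L₁ L₂)
  have hr (x : FreeProd F L₁ L₂) :
      r x = x - inl F L₁ L₂ (fst F L₁ L₂ x) - inr F L₁ L₂ (snd F L₁ L₂ x) := rfl
  let S : LieSubalgebra F (FreeProd F L₁ L₂) :=
    { (derived F (FreeProd F L₁ L₂)).toSubmodule.comap r with
      lie_mem' := fun {x y} _ _ => by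
        change r ⁅x, y⁆ ∈ derived F (FreeProd F L₁ L₂)
        rw [hr]
        simp only [LieHom.map_lie]
        exact sub_mem (sub_mem (lie_mem_derived _ _) (lie_mem_derived _ _)) (lie_mem_derived _ _) }
  have hx : x ∈ S := mem_of_inl_mem_of_inr_mem
    (fun x => by change r _ ∈ derived F (FreeProd F L₁ L₂); simp [hr])
    (fun y => by change r _ ∈ derived F (FreeProd F L₁ L₂); simp [hr]) x
  rw [← sub_sub]
  exact hx

theorem FreeProd.mem_derived_of_prod_mem_derived {x : FreeProd F L₁ L₂}
    (hx : (fst F L₁ L₂).prod (snd F L₁ L₂) x ∈ derived F (L₁ × L₂)) :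
    x ∈ derived F (FreeProd F L₁ L₂) := by
  have h₁ : fst F L₁ L₂ x ∈ derived F L₁ := map_mem_derived (LieHom.fst F L₁ L₂) hx
  have h₂ : snd F L₁ L₂ x ∈ derived F L₂ := map_mem_derived (LieHom.snd F L₁ L₂) hx
  have h := add_mem (sub_inl_fst_add_inr_snd_mem_derived x)
    (add_mem (map_mem_derived (inl F L₁ L₂) h₁) (map_mem_derived (inr F L₁ L₂) h₂))
  rwa [sub_add_cancel] at h

variable (F L₁ L₂) in
/-- The projection of the tensor square of a free product onto the sum of the tensor squares of the
factors. -/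
def factorProj : SelfTensor F (FreeProd F L₁ L₂) →ₗ[F] SelfTensor F (FreeProd F L₁ L₂) :=
  (selfMap (FreeProd.inl F L₁ L₂)).toLinearMap ∘ₗ (selfMap (FreeProd.fst F L₁ L₂)).toLinearMap +
    (selfMap (FreeProd.inr F L₁ L₂)).toLinearMap ∘ₗ (selfMap (FreeProd.snd F L₁ L₂)).toLinearMap

theorem factorProj_apply (t : SelfTensor F (FreeProd F L₁ L₂)) : factorProj F L₁ L₂ t =
    selfMap (FreeProd.inl F L₁ L₂) (selfMap (FreeProd.fst F L₁ L₂) t) +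
      selfMap (FreeProd.inr F L₁ L₂) (selfMap (FreeProd.snd F L₁ L₂) t) := rfl

@[simp]
theorem factorProj_inl (x y : L₁) :
    factorProj F L₁ L₂ (selfTmul F (FreeProd.inl F L₁ L₂ x) (FreeProd.inl F L₁ L₂ y)) =
      selfTmul F (FreeProd.inl F L₁ L₂ x) (FreeProd.inl F L₁ L₂ y) := by
  simp [factorProj_apply]

@[simp]
theorem factorProj_inr (x y : L₂) :
    factorProj F L₁ L₂ (selfTmul F (FreeProd.inr F L₁ L₂ x) (FreeProd.inr F L₁ L₂ y)) =
      selfTmul F (FreeProd.inr F L₁ L₂ x) (FreeProd.inr F L₁ L₂ y) := by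
  simp [factorProj_apply]

theorem selfTmul_self_eq_factorProj_add (x : FreeProd F L₁ L₂) :
    selfTmul F x x = factorProj F L₁ L₂ (selfTmul F x x) +
      symTmul F _ (FreeProd.inl F L₁ L₂ (FreeProd.fst F L₁ L₂ x))
        (FreeProd.inr F L₁ L₂ (FreeProd.snd F L₁ L₂ x)) := by
  nth_rw 1 [selfTmul_self_congr (FreeProd.sub_inl_fst_add_inr_snd_mem_derived x)]
  rw [factorProj_apply, symTmul_apply]
  simp only [map_add, LinearMap.add_apply, selfMap_selfTmul]
  abel

theorem eq_factorProj_add_of_mem_J₂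
    {Φ : SelfTensor F (FreeProd F L₁ L₂) →ₗ⁅F⁆ CoinvTensor (⊤ : LieIdeal F L₁) (⊤ : LieIdeal F L₂)}
    (hΦ : ∀ x y, Φ (selfTmul F x y) =
      tmul 0 0 (abMk F L₁ (FreeProd.fst F L₁ L₂ x)) (abMk F L₂ (FreeProd.snd F L₁ L₂ y)))
    {Ψ : CoinvTensor (⊤ : LieIdeal F L₁) (⊤ : LieIdeal F L₂) →ₗ⁅F⁆ SelfTensor F (FreeProd F L₁ L₂)}
    (hΨ : ∀ x y, Ψ (tmul 0 0 (abMk F L₁ x) (abMk F L₂ y)) =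
      symTmul F _ (FreeProd.inl F L₁ L₂ x) (FreeProd.inr F L₁ L₂ y))
    {t : SelfTensor F (FreeProd F L₁ L₂)} (ht : t ∈ J₂ ⊤) :
    t = factorProj F L₁ L₂ t + Ψ (Φ t) := by
  let P := LinearMap.id - (factorProj F L₁ L₂ + Ψ.toLinearMap ∘ₗ Φ.toLinearMap)
  have hP (t : SelfTensor F (FreeProd F L₁ L₂)) : P t = t - (factorProj F L₁ L₂ t + Ψ (Φ t)) := rfl
  refine sub_eq_zero.mp (map_eq_zero_of_mem_J₂ P (fun x => ?_) (fun x y => ?_) (fun x y => ?_) ht)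
  · rw [hP, hΦ, hΨ, ← selfTmul_self_eq_factorProj_add, sub_self]
  · simp [hP, hΦ]
  · simp [hP, hΦ]

theorem factorProj_mem_diagonal {t : SelfTensor F (FreeProd F L₁ L₂)} (ht : t ∈ diagonal ⊤) :
    factorProj F L₁ L₂ t ∈ diagonal ⊤ :=
  add_mem (pairMap_mem_diagonal _ _ (pairMap_mem_diagonal _ _ ht))
    (pairMap_mem_diagonal _ _ (pairMap_mem_diagonal _ _ ht))

theorem quotMk_factorProj_of_mem_J₂ {t : SelfTensor F (FreeProd F L₁ L₂)} (ht : t ∈ J₂ ⊤) :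
    quotMk (diagonal ⊤) (factorProj F L₁ L₂ t) = quotMk (diagonal ⊤) t := by
  let P := (quotMk (diagonal (⊤ : LieIdeal F (FreeProd F L₁ L₂)))).toLinearMap ∘ₗ
    (factorProj F L₁ L₂ - LinearMap.id)
  have hP (t : SelfTensor F (FreeProd F L₁ L₂)) :
      P t = quotMk (diagonal ⊤) (factorProj F L₁ L₂ t - t) := rfl
  rw [← sub_eq_zero, ← map_sub]
  refine map_eq_zero_of_mem_J₂ P (fun x => ?_) (fun x y => ?_) (fun x y => ?_) ht
  · have hx := selfTmul_self_mem_diagonal (F := F) x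
    exact quotMk_eq_zero.mpr (sub_mem (factorProj_mem_diagonal hx) hx)
  · rw [hP, factorProj_inl, sub_self, map_zero]
  · rw [hP, factorProj_inr, sub_self, map_zero]

theorem exists_linearMap_selfMap_diagonal {f : L₁ →ₗ⁅F⁆ L₂} (hf : Function.Surjective f)
    (hder : ∀ x, f x ∈ derived F L₂ → x ∈ derived F L₁) :
    ∃ e : SelfTensor F L₂ →ₗ[F] SelfTensor F L₁,
      ∀ t ∈ diagonal (⊤ : LieIdeal F L₁), e (selfMap f t) = t := by
  obtain ⟨r, hr⟩ := (f : L₁ →ₗ[F] L₂).exists_rightInverse_of_surjective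
    (LinearMap.range_eq_top.mpr hf)
  obtain ⟨s, hs⟩ := exists_abMk_section (F := F) (L := L₂)
  let σ : L₂ →ₗ[F] L₁ := r ∘ₗ s ∘ₗ (abMk F L₂ : L₂ →ₗ[F] Coinv (⊤ : LieIdeal F L₂))
  have hσ_lie (x y : L₂) : σ ⁅x, y⁆ = 0 := by simp [σ, lie_coinv_eq_zero]
  have hσ (x : L₁) : σ (f x) - x ∈ derived F L₁ := hder _ <| by
    have hfr (y : L₂) : f (r y) = y := LinearMap.congr_fun hr y
    rw [map_sub]
    change f (r _) - f x ∈ _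
    rw [hfr]
    exact hs (f x)
  obtain ⟨e, he⟩ := exists_linearMap_selfTmul ((selfTmul F).compl₁₂ σ σ)
    (fun x y z => by simp [hσ_lie]) (fun x y z => by simp [hσ_lie])
  refine ⟨e, fun t ht => ?_⟩
  rw [← LieSubmodule.mem_toSubmodule, diagonal_top_eq_span] at ht
  have heq : Set.EqOn (e ∘ₗ (selfMap f : SelfTensor F L₁ →ₗ[F] SelfTensor F L₂))
      (LinearMap.id : SelfTensor F L₁ →ₗ[F] SelfTensor F L₁)
      (Set.range fun x : L₁ => selfTmul F x x) := by
    rintro _ ⟨x, rfl⟩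
    simp only [LinearMap.comp_apply, LieHom.coe_toLinearMap, selfMap_selfTmul, he,
      LinearMap.compl₁₂_apply, LinearMap.id_apply]
    exact selfTmul_self_congr (hσ x)
  exact LinearMap.eqOn_span heq ht

variable (F L₁ L₂) in
theorem freeProdSubalgebra_top :
    freeProdSubalgebra (⊤ : LieIdeal F L₁) (⊤ : LieIdeal F L₂) = ⊤ :=
  eq_top_iff.mpr fun t _ => FreeProd.mem_of_inl_mem_of_inr_mem
    (fun x => inl_mem_freeProdSubalgebra (LieSubmodule.mem_top x))
    (fun y => inr_mem_freeProdSubalgebra (LieSubmodule.mem_top y)) t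

variable (F L₁ L₂) in
theorem nonempty_J₂_freeProd_equiv : Nonempty (J₂ (⊤ : LieIdeal F (FreeProd F L₁ L₂)) ≃ₗ⁅F⁆
    (J₂ (⊤ : LieIdeal F L₁) × J₂ (⊤ : LieIdeal F L₂) ×
      CoinvTensor (⊤ : LieIdeal F L₁) (⊤ : LieIdeal F L₂))) := by
  obtain ⟨Φ, hΦ⟩ := exists_lieHom_selfTensor_coinvTensor (FreeProd.fst F L₁ L₂)
    (FreeProd.snd F L₁ L₂)
  obtain ⟨Ψ, hΨ⟩ := exists_lieHom_coinvTensor_symTmul (FreeProd.inl F L₁ L₂)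
    (FreeProd.inr F L₁ L₂)
  have hκΨ : (kappa ⊤).toLinearMap ∘ₗ Ψ.toLinearMap = 0 :=
    coinvTensor_linearMap_ext fun x y => by simp [hΨ, kappa_symTmul]
  have hΦΨ : Φ.toLinearMap ∘ₗ Ψ.toLinearMap = LinearMap.id :=
    coinvTensor_linearMap_ext fun x y => by simp [hΨ, hΦ, symTmul_apply]
  have hΦ₁ : Φ.toLinearMap ∘ₗ (selfMap (FreeProd.inl F L₁ L₂)).toLinearMap = 0 :=
    selfTensor_linearMap_ext fun x y => by simp [hΦ]
  have hΦ₂ : Φ.toLinearMap ∘ₗ (selfMap (FreeProd.inr F L₁ L₂)).toLinearMap = 0 :=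
    selfTensor_linearMap_ext fun x y => by simp [hΦ]
  have hΨ₁ : (selfMap (FreeProd.fst F L₁ L₂)).toLinearMap ∘ₗ Ψ.toLinearMap = 0 :=
    coinvTensor_linearMap_ext fun x y => by simp [hΨ, symTmul_apply]
  have hΨ₂ : (selfMap (FreeProd.snd F L₁ L₂)).toLinearMap ∘ₗ Ψ.toLinearMap = 0 :=
    coinvTensor_linearMap_ext fun x y => by simp [hΨ, symTmul_apply]
  exact nonempty_J₂_equiv_prod (freeProdSubalgebra_top F L₁ L₂).symm Φ Ψ
    (fun s => mem_J₂.mpr (LinearMap.congr_fun hκΨ s)) (LinearMap.congr_fun hΦΨ)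
    (LinearMap.congr_fun hΦ₁) (LinearMap.congr_fun hΦ₂) (LinearMap.congr_fun hΨ₁)
    (LinearMap.congr_fun hΨ₂) fun t ht => eq_factorProj_add_of_mem_J₂ hΦ hΨ ht

variable (F L₁ L₂) in
theorem nonempty_schurMultiplier_freeProd_equiv :
    Nonempty (schurMultiplier (⊤ : LieIdeal F (FreeProd F L₁ L₂)) ≃ₗ⁅F⁆
      (schurMultiplier (⊤ : LieIdeal F L₁) × schurMultiplier (⊤ : LieIdeal F L₂))) :=
  nonempty_schurMultiplier_equiv_prod (freeProdSubalgebra_top F L₁ L₂).symm fun t ht => by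
    rw [← map_add]
    exact (quotMk_factorProj_of_mem_J₂ ht).symm

variable (F L₁ L₂) in
theorem nonempty_diagonal_freeProd_equiv :
    Nonempty (diagonal (⊤ : LieIdeal F (FreeProd F L₁ L₂)) ≃ₗ⁅F⁆
      diagonal (prodIdeal (⊤ : LieIdeal F L₁) (⊤ : LieIdeal F L₂))) := by
  obtain ⟨e, he⟩ := exists_linearMap_selfMap_diagonal
    (f := (FreeProd.fst F L₁ L₂).prod (FreeProd.snd F L₁ L₂))
    (fun ⟨x, y⟩ => ⟨FreeProd.inl F L₁ L₂ x + FreeProd.inr F L₁ L₂ y,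
      Prod.ext (by simp) (by simp)⟩) fun _ => FreeProd.mem_derived_of_prod_mem_derived
  refine nonempty_diagonal_equiv_diagonal_prodIdeal (freeProdSubalgebra_top F L₁ L₂).symm
    fun t ht hzero => ?_
  have hself : selfMap ((FreeProd.fst F L₁ L₂).prod (FreeProd.snd F L₁ L₂)) t = 0 := by
    rw [selfMap, ← pairMap_pairMap _
      (fun _ => prod_fst_snd_mem (freeProdSubalgebra_top F L₁ L₂).symm) LieHom.id
      (fun _ _ => LieSubmodule.mem_top _) _ _ fun _ => rfl, hzero, map_zero]
  rw [← he t ht, hself, map_zero]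

end FullCase

section Dichotomy

variable {F : Type u} {L₁ : Type v} {L₂ : Type w} [Field F] [LieRing L₁] [LieAlgebra F L₁]
  [LieRing L₂] [LieAlgebra F L₂] {N₁ : LieIdeal F L₁} {N₂ : LieIdeal F L₂}
  {N : LieIdeal F (FreeProd F L₁ L₂)} (hN : N.toLieSubalgebra = freeProdSubalgebra N₁ N₂)

include hN

theorem eq_pairInl_add_pairInr_of_subsingleton_left [Subsingleton L₁] (t : PairTensor N) :
    t = pairInl hN (pairFst hN t) + pairInr hN (pairSnd hN t) := by
  have hid : (FreeProd.inr F L₁ L₂).comp (FreeProd.snd F L₁ L₂) = LieHom.id :=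
    FreeProd.hom_ext (fun x => by simp [Subsingleton.elim x 0]) fun y => by simp
  have hinr (x : FreeProd F L₁ L₂) : FreeProd.inr F L₁ L₂ (FreeProd.snd F L₁ L₂ x) = x :=
    LieHom.congr_fun hid x
  have : Subsingleton (PairTensor N₁) := subsingleton_tensor_of_left
  rw [pairMap_pairMap_eq_self _ _ _ _ hinr, Subsingleton.elim (pairFst hN t) 0, map_zero, zero_add]

theorem eq_pairInl_add_pairInr_of_subsingleton_right [Subsingleton L₂] (t : PairTensor N) :
    t = pairInl hN (pairFst hN t) + pairInr hN (pairSnd hN t) := by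
  have hid : (FreeProd.inl F L₁ L₂).comp (FreeProd.fst F L₁ L₂) = LieHom.id :=
    FreeProd.hom_ext (fun x => by simp) fun y => by simp [Subsingleton.elim y 0]
  have hinl (x : FreeProd F L₁ L₂) : FreeProd.inl F L₁ L₂ (FreeProd.fst F L₁ L₂ x) = x :=
    LieHom.congr_fun hid x
  have : Subsingleton (PairTensor N₂) := subsingleton_tensor_of_left
  rw [pairMap_pairMap_eq_self _ _ _ _ hinl, Subsingleton.elim (pairSnd hN t) 0, map_zero, add_zero]

theorem split_or_top :
    ((∀ t : PairTensor N, t = pairInl hN (pairFst hN t) + pairInr hN (pairSnd hN t)) ∧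
      Subsingleton (CoinvTensor N₁ N₂)) ∨ N₁ = ⊤ ∧ N₂ = ⊤ := by
  rcases subsingleton_or_bot_or_top hN with _ | _ | ⟨rfl, rfl⟩ | h
  · have : Subsingleton (Coinv N₁) := (quotMk_surjective _).subsingleton
    exact .inl ⟨eq_pairInl_add_pairInr_of_subsingleton_left hN, subsingleton_tensor_of_left⟩
  · have : Subsingleton (Coinv N₂) := (quotMk_surjective _).subsingleton
    exact .inl ⟨eq_pairInl_add_pairInr_of_subsingleton_right hN, subsingleton_tensor_of_right⟩
  · have hbot : freeProdSubalgebra (⊥ : LieIdeal F L₁) (⊥ : LieIdeal F L₂) ≤ ⊥ :=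
      freeProdSubalgebra_le (by simp +contextual) (by simp +contextual)
    have : Subsingleton N :=
      ⟨fun x y => Subtype.ext ((hbot (hN.le x.2)).trans (hbot (hN.le y.2)).symm)⟩
    have : Subsingleton (PairTensor N) := subsingleton_tensor_of_right
    have : Subsingleton (Coinv (⊥ : LieIdeal F L₁)) := (quotMk_surjective _).subsingleton
    exact .inl ⟨fun _ => Subsingleton.elim _ _, subsingleton_tensor_of_left⟩
  · exact .inr h

end Dichotomy

end LiePair

end

open LiePair in
theorem mainTheorem4_general {F : Type*} [Field F] {L₁ : Type*} [LieRing L₁] [LieAlgebra F L₁]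
    {L₂ : Type*} [LieRing L₂] [LieAlgebra F L₂] (N₁ : LieIdeal F L₁) (N₂ : LieIdeal F L₂)
    (N : LieIdeal F (FreeProd F L₁ L₂)) (hN : N.toLieSubalgebra = freeProdSubalgebra N₁ N₂) :
    Nonempty (J₂ N ≃ₗ⁅F⁆ (J₂ N₁ × J₂ N₂ × CoinvTensor N₁ N₂)) ∧
    Nonempty (diagonal N ≃ₗ⁅F⁆ diagonal (prodIdeal N₁ N₂)) ∧
    Nonempty (schurMultiplier N ≃ₗ⁅F⁆ (schurMultiplier N₁ × schurMultiplier N₂)) := by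
  rcases split_or_top hN with ⟨hsplit, _⟩ | ⟨rfl, rfl⟩
  · exact ⟨nonempty_J₂_equiv_of_split hN hsplit, nonempty_diagonal_equiv_of_split hN hsplit,
      nonempty_schurMultiplier_equiv_of_split hN hsplit⟩
  · obtain rfl : N = ⊤ := eq_top_iff.mpr fun t _ =>
      hN.ge (by rw [freeProdSubalgebra_top]; exact LieSubalgebra.mem_top t)
    exact ⟨nonempty_J₂_freeProd_equiv F L₁ L₂, nonempty_diagonal_freeProd_equiv F L₁ L₂,
      nonempty_schurMultiplier_freeProd_equiv F L₁ L₂⟩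

open LiePair in
theorem mainTheorem4 {F : Type*} [Field F]
    {L₁ : Type*} [LieRing L₁] [LieAlgebra F L₁] [FiniteDimensional F L₁]
    {L₂ : Type*} [LieRing L₂] [LieAlgebra F L₂] [FiniteDimensional F L₂]
    (N₁ : LieIdeal F L₁) (N₂ : LieIdeal F L₂)
    -- `(L₁ * L₂, N₁ * N₂)` is a pair: `N` is an ideal of `L₁ * L₂`, and it is `N₁ * N₂`
    (N : LieIdeal F (FreeProd F L₁ L₂))
    (hN : N.toLieSubalgebra = freeProdSubalgebra N₁ N₂) :
    Nonempty (J₂ N ≃ₗ⁅F⁆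
      (J₂ N₁ × J₂ N₂ ×
        NonabTensor (0 : Coinv N₁ →ₗ⁅F⁆ LieDerivation F (Coinv N₂) (Coinv N₂))
          (0 : Coinv N₂ →ₗ⁅F⁆ LieDerivation F (Coinv N₁) (Coinv N₁)))) ∧
    Nonempty (diagonal N ≃ₗ⁅F⁆ diagonal (prodIdeal N₁ N₂)) ∧
    ((∃ K : LieSubalgebra F L₁, IsCompl K.toSubmodule N₁.toSubmodule) →
      ⁅N₁, (⊤ : LieIdeal F L₁)⁆ = ⁅(⊤ : LieIdeal F L₁), (⊤ : LieIdeal F L₁)⁆ →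
      Nonempty (schurMultiplier N ≃ₗ⁅F⁆ (schurMultiplier N₁ × schurMultiplier N₂))) := by
  obtain ⟨hJ₂, hdiag, hschur⟩ := mainTheorem4_general N₁ N₂ N hN
  exact ⟨hJ₂, hdiag, fun _ _ => hschur⟩
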